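/- Let $T>0$, $\varepsilon>0$, $H\in(\tfrac12,1]$, $0<\sigma^L<\sigma^H$ and $\lambda_L,\lambda_H>0$. On a probability space with a filtration, let $N_L,N_H$ be independent Poisson processes relative to the filtration, with intensities $\lambda_L,\lambda_H$ (for $s\le t$ the increments of $N_L$ and $N_H$ over $(s,t]$ are independent of each other and jointly independent of the past up to $s$). Let $\sigma$ be an adapted càdlàg process with $\sigma_0\in\{\sigma^L,\sigma^H\}$ almost surely and $$d\sigma_t=(\sigma^H-\sigma_{t-})\,dN_L(t)-(\sigma_{t-}-\sigma^L)\,dN_H(t),$$ so that $\sigma$ is a continuous-time Markov chain that jumps from $\sigma^L$ to $\sigma^H$ with intensity $\lambda_L$ and from $\sigma^H$ to $\sigma^L$ with intensity $\lambda_H$. Let $\mathcal F^\sigma_t$ be the $\sigma$-algebra generated by $(\sigma_s)_{0\le s\le t}$. A bounded solution of the $G$-equation is a bounded, jointly measurable, $(\mathcal F^\sigma_t)$-adapted process $(G_t)_{t\in[0,T]}$ with, almost surely for each fixed $t$, $G_t\ge 0$, and $G_t>0$ if $t<T$, such that $\sigma_s^2/\sqrt{G_s}$ is integrable on $[0,T]\times\Omega$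 and, for every $t\in[0,T]$, $$\sqrt{G_t}=\mathrm E\left[\left.\int_t^T\frac{\varepsilon^{2H-1}\sigma_s^2}{2\sqrt{G_s}}\,ds\,\right|\,\mathcal F^\sigma_t\right]\quad\text{a.s.}$$ Then the system $$\begin{cases}\dfrac{dG^L}{d\tau}(\tau)=(\sigma^L)^2+2\lambda_L\left(\sqrt{G^H(\tau)G^L(\tau)}-G^L(\tau)\right),\\[2mm] \dfrac{dG^H}{d\tau}(\tau)=(\sigma^H)^2+2\lambda_H\left(\sqrt{G^H(\tau)G^L(\tau)}-G^H(\tau)\right),\end{cases}\qquad G^L(0)=G^H(0)=0,$$ has exactly one nonnegative solution $(G^L,G^H)$ on $[0,T]$, and $$G_t=\mathbf 1_{\{\sigma_t=\sigma^L\}}\,\varepsilon^{2H-1}G^L(T-t)+\mathbf 1_{\{\sigma_t=\sigma^H\}}\,\varepsilon^{2H-1}G^H(T-t),\qquad t\in[0,T],$$ is the unique bounded solution of the $G$-equation: it is a bounded solution, and every bounded solution agrees with it almost surely at each $t\in[0,T]$. -/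

import Mathlib

open MeasureTheory ProbabilityTheory Set Filter Topology

noncomputable section

namespace TwoStateVolatility

variable {Ω : Type*} [mΩ : MeasurableSpace Ω]

/-- Time is a real number; only times `t ≥ 0` are ever used.
`N` is a Poisson process of intensity `r` relative to the filtration `𝔽`:
an adapted, integer-valued process that starts at `0`, has nondecreasing right-continuous paths,
and whose increment over `(s, t]` is Poisson distributed with parameter `r (t - s)` and is
independent of `𝔽 s`. -/
structure IsPoissonProcess (P : Measure Ω) (𝔽 : Filtration ℝ mΩ) (N : ℝ → Ω → ℕ) (r : ℝ) :
    Prop where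
  adapted : ∀ t, 0 ≤ t → Measurable[𝔽 t] (N t)
  zero : ∀ ω, N 0 ω = 0
  mono : ∀ ω, MonotoneOn (fun t => N t ω) (Ici 0)
  right_cont : ∀ ω t, 0 ≤ t → ContinuousWithinAt (fun u => N u ω) (Ici t) t
  law : ∀ s t, 0 ≤ s → s ≤ t →
    P.map (fun ω => N t ω - N s ω) = poissonMeasure (r * (t - s)).toNNReal
  indep : ∀ s t, 0 ≤ s → s ≤ t →
    Indep (MeasurableSpace.comap (fun ω => N t ω - N s ω) inferInstance) (𝔽 s) P

/-- `N₁` and `N₂` are Poisson processes relative to `𝔽` that are independent of each other: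
for all `s ≤ t` their increments over `(s, t]` are independent of each other, and the pair of
these increments is independent of `𝔽 s`. -/
structure IsIndepPoissonPair (P : Measure Ω) (𝔽 : Filtration ℝ mΩ) (N₁ N₂ : ℝ → Ω → ℕ)
    (r₁ r₂ : ℝ) : Prop where
  fst : IsPoissonProcess P 𝔽 N₁ r₁
  snd : IsPoissonProcess P 𝔽 N₂ r₂
  indep_incr : ∀ s t, 0 ≤ s → s ≤ t →
    IndepFun (fun ω => N₁ t ω - N₁ s ω) (fun ω => N₂ t ω - N₂ s ω) P
  indep_past : ∀ s t, 0 ≤ s → s ≤ t →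
    Indep (MeasurableSpace.comap (fun ω => (N₁ t ω - N₁ s ω, N₂ t ω - N₂ s ω)) inferInstance)
      (𝔽 s) P

/-- The pathwise integral `∫_{(0,t]} h(s-) dN(s)` against a counting path `N`, that is, the sum of
`h(s-) (N(s) - N(s-))` over `0 < s ≤ t`. A nondecreasing integer-valued path has only finitely
many jumps in `(0, t]`, so the sum is finite. -/
def jumpIntegral (h : ℝ → ℝ) (N : ℝ → ℕ) (t : ℝ) : ℝ :=
  ∑ᶠ s ∈ Ioc (0 : ℝ) t,
    Function.leftLim h s * ((N s : ℝ) - Function.leftLim (fun u => (N u : ℝ)) s)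

/-- `σ` is an adapted càdlàg process with initial value in `{σL, σH}` that solves
`dσ_t = (σH - σ_{t-}) dN_L(t) - (σ_{t-} - σL) dN_H(t)`. -/
structure IsVolatility (P : Measure Ω) (𝔽 : Filtration ℝ mΩ) (NL NH : ℝ → Ω → ℕ)
    (σL σH : ℝ) (σ : ℝ → Ω → ℝ) : Prop where
  adapted : ∀ t, 0 ≤ t → Measurable[𝔽 t] (σ t)
  right_cont : ∀ ω t, 0 ≤ t → ContinuousWithinAt (fun u => σ u ω) (Ici t) t
  left_lim : ∀ ω t, 0 < t → ∃ l, Tendsto (fun u => σ u ω) (𝓝[<] t) (𝓝 l)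
  initial : ∀ᵐ ω ∂P, σ 0 ω = σL ∨ σ 0 ω = σH
  sde : ∀ᵐ ω ∂P, ∀ t, 0 ≤ t →
    σ t ω = σ 0 ω + jumpIntegral (fun u => σH - σ u ω) (fun u => NL u ω) t
      - jumpIntegral (fun u => σ u ω - σL) (fun u => NH u ω) t

/-- The σ-algebra generated by the history `(σ_s)_{0 ≤ s ≤ t}` of the volatility. -/
@[reducible]
def history (σ : ℝ → Ω → ℝ) (t : ℝ) : MeasurableSpace Ω :=
  ⨆ s ∈ Icc (0 : ℝ) t, MeasurableSpace.comap (σ s) inferInstance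

/-- `G` is a bounded solution on `[0, T]` of
`√(G_t) = E[∫_t^T ε^(2H-1) σ_s² / (2 √(G_s)) ds | F_t^σ]`:
a bounded, jointly measurable process, adapted to the history of `σ`, which is nonnegative and
positive before `T` (so that the quotient is genuine), whose integrand is integrable, and which
satisfies the equation almost surely at every time. -/
structure IsBoundedSolution (P : Measure Ω) (σ : ℝ → Ω → ℝ) (T ε H : ℝ) (G : ℝ → Ω → ℝ) :
    Prop where
  measurable : Measurable (fun p : Icc (0 : ℝ) T × Ω => G p.1 p.2)
  adapted : ∀ t ∈ Icc 0 T, Measurable[history σ t] (G t)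
  nonneg : ∀ t ∈ Icc 0 T, ∀ᵐ ω ∂P, 0 ≤ G t ω
  pos : ∀ t ∈ Ico 0 T, ∀ᵐ ω ∂P, 0 < G t ω
  bounded : ∃ C : ℝ, ∀ t ∈ Icc 0 T, ∀ᵐ ω ∂P, G t ω ≤ C
  integrable : Integrable
    (fun p : ℝ × Ω => ε ^ (2 * H - 1) * σ p.1 p.2 ^ 2 / (2 * √(G p.1 p.2)))
    ((volume.restrict (Ioc 0 T)).prod P)
  eqn : ∀ t ∈ Icc 0 T,
    (fun ω => √(G t ω)) =ᵐ[P]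
      P[fun ω => ∫ s in t..T, ε ^ (2 * H - 1) * σ s ω ^ 2 / (2 * √(G s ω)) | history σ t]

/-- `(gL, gH)` is a (nonnegative) solution on `[0, T]` of
`gL' = σL² + 2 lL (√(gH gL) - gL)`, `gH' = σH² + 2 lH (√(gH gL) - gH)`, `gL(0) = gH(0) = 0`. -/
structure IsODESolution (σL σH lL lH T : ℝ) (gL gH : ℝ → ℝ) : Prop where
  initial_low : gL 0 = 0
  initial_high : gH 0 = 0
  nonneg_low : ∀ τ ∈ Icc 0 T, 0 ≤ gL τ
  nonneg_high : ∀ τ ∈ Icc 0 T, 0 ≤ gH τ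
  deriv_low : ∀ τ ∈ Icc 0 T,
    HasDerivWithinAt gL (σL ^ 2 + 2 * lL * (√(gH τ * gL τ) - gL τ)) (Icc 0 T) τ
  deriv_high : ∀ τ ∈ Icc 0 T,
    HasDerivWithinAt gH (σH ^ 2 + 2 * lH * (√(gH τ * gL τ) - gH τ)) (Icc 0 T) τ

/-- The process `1_{σ_t = σL} ε^(2H-1) gL(T-t) + 1_{σ_t = σH} ε^(2H-1) gH(T-t)`. -/
def stateProcess (σ : ℝ → Ω → ℝ) (σL σH T ε H : ℝ) (gL gH : ℝ → ℝ) (t : ℝ) (ω : Ω) : ℝ :=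
  {ω' | σ t ω' = σL}.indicator (fun _ => ε ^ (2 * H - 1) * gL (T - t)) ω
    + {ω' | σ t ω' = σH}.indicator (fun _ => ε ^ (2 * H - 1) * gH (T - t)) ω

end TwoStateVolatility

end

/-! The key is to work with square roots. With `x = √gL` and `y = √gH` the system becomes `x' = σL²
/ (2 x) + lL (y - x)` and symmetrically for `y`. The singular drift decreases in its own variable
and the coupling is dissipative, so the weighted squared distance of two solutions does not
increase; as it starts at zero, solutions are unique (`IsODESolution.eqOn_low`). Existence
(`exists_isODESolution`) comes from monotone iteration in variation-of-constants form, which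
tolerates the failure of the Lipschitz condition at the origin.

That the state process solves the equation is a duality argument. For an event `A` of the past of
`t`, the function `p(s) = P(A ∩ {σ_s = σH})` solves the forward equation `p' = lL P(A) - (lL + lH)
p` (`IsVolatility.hasDerivWithinAt_real_high`), which follows from an estimate over a short interval
with at most one jump. Pairing `p` with the square roots of the scaled solution at time `T - s`
makes all coupling terms cancel; what remains is the mean of the integrand over `A`
(`IsODESolution.integral_forward`). Since the square roots vanish at `s = T`, integration gives the
defining identity of the conditional expectation.

Uniqueness of bounded solutions (`ae_eq_of_backward_eq`) again uses that `x ↦ 1 / x` decreases. If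
`f` is the difference of the two integrands and `X`, `Y` are the square roots, then `E (∫_t^T f)² =
2 ∫_t^T E[f_s ∫_s^T f] ds = 2 ∫_t^T E[f_s (X_s - Y_s)] ds ≤ 0`. So the tail integral of `f` vanishes
almost surely, and conditioning gives `X_t = Y_t`. Boundedness is what makes the product under the
integral integrable. -/

noncomputable section

namespace TwoStateVolatility

/-! ### The system of differential equations: uniqueness and existence. -/

section ODE

variable {σL σH lL lH T : ℝ} {gL gH KL KH : ℝ → ℝ}

/-- The coupling `√(gH gL)` is symmetric, so the two states can be exchanged. This lets the facts
below be proved for the low component only. -/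
theorem IsODESolution.symm (h : IsODESolution σL σH lL lH T gL gH) :
    IsODESolution σH σL lH lL T gH gL where
  initial_low := h.initial_high
  initial_high := h.initial_low
  nonneg_low := h.nonneg_high
  nonneg_high := h.nonneg_low
  deriv_low τ hτ := by simpa only [mul_comm (gL τ)] using h.deriv_high τ hτ
  deriv_high τ hτ := by simpa only [mul_comm (gL τ)] using h.deriv_low τ hτ

theorem IsODESolution.continuousOn_low (h : IsODESolution σL σH lL lH T gL gH) :
    ContinuousOn gL (Icc 0 T) := fun τ hτ => (h.deriv_low τ hτ).continuousWithinAt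

theorem IsODESolution.hasDerivAt_low (h : IsODESolution σL σH lL lH T gL gH) {τ : ℝ}
    (hτ : τ ∈ Ioo 0 T) :
    HasDerivAt gL (σL ^ 2 + 2 * lL * (√(gH τ * gL τ) - gL τ)) τ :=
  (h.deriv_low τ (Ioo_subset_Icc_self hτ)).hasDerivAt (Icc_mem_nhds hτ.1 hτ.2)

/-- A solution of the system grows at least linearly. -/
theorem IsODESolution.linear_le_low (h : IsODESolution σL σH lL lH T gL gH) (hl : 0 < lL)
    {τ : ℝ} (hτ : τ ∈ Icc 0 T) : σL ^ 2 * Real.exp (-(2 * lL * T)) * τ ≤ gL τ := by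
  -- The integrating factor removes the term `-2 lL gL`; the remaining source is at least `σL²`.
  have hmono : MonotoneOn (fun s => Real.exp (2 * lL * s) * gL s - σL ^ 2 * s) (Icc 0 T) := by
    have hd : ∀ s ∈ Ioo 0 T, HasDerivAt (fun s => Real.exp (2 * lL * s) * gL s - σL ^ 2 * s)
        (Real.exp (2 * lL * s) * (σL ^ 2 + 2 * lL * √(gH s * gL s)) - σL ^ 2) s := by
      intro s hs
      have h1 : HasDerivAt (fun s => Real.exp (2 * lL * s))
          (Real.exp (2 * lL * s) * (2 * lL * 1)) s :=
        ((hasDerivAt_id s).const_mul (2 * lL)).exp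
      convert! (h1.mul (h.hasDerivAt_low hs)).sub ((hasDerivAt_id s).const_mul (σL ^ 2)) using 1
      ring
    refine monotoneOn_of_deriv_nonneg (convex_Icc 0 T) ?_ ?_ ?_
    · exact ((by fun_prop : Continuous fun s => Real.exp (2 * lL * s)).continuousOn.mul
        h.continuousOn_low).sub (by fun_prop)
    · rw [interior_Icc]
      exact fun s hs => (hd s hs).differentiableAt.differentiableWithinAt
    · rw [interior_Icc]
      intro s hs
      rw [(hd s hs).deriv]
      have h1 : 1 ≤ Real.exp (2 * lL * s) := Real.one_le_exp (by have := hs.1; positivity)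
      have h2 : 0 ≤ 2 * lL * √(gH s * gL s) := by positivity
      nlinarith [sq_nonneg σL]
  have h0 := hmono ⟨le_rfl, hτ.1.trans hτ.2⟩ hτ hτ.1
  simp only [h.initial_low, mul_zero, sub_zero] at h0
  have h1 : σL ^ 2 * τ ≤ Real.exp (2 * lL * T) * gL τ := by
    have : Real.exp (2 * lL * τ) * gL τ ≤ Real.exp (2 * lL * T) * gL τ :=
      mul_le_mul_of_nonneg_right (Real.exp_le_exp.2 (by nlinarith [hτ.2])) (h.nonneg_low τ hτ)
    linarith
  have h2 : Real.exp (-(2 * lL * T)) * Real.exp (2 * lL * T) = 1 := by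
    rw [← Real.exp_add]; simp
  calc σL ^ 2 * Real.exp (-(2 * lL * T)) * τ = Real.exp (-(2 * lL * T)) * (σL ^ 2 * τ) := by ring
    _ ≤ Real.exp (-(2 * lL * T)) * (Real.exp (2 * lL * T) * gL τ) := by gcongr
    _ = gL τ := by rw [← mul_assoc, h2, one_mul]

theorem IsODESolution.pos_low (h : IsODESolution σL σH lL lH T gL gH) (hσ : 0 < σL)
    (hl : 0 < lL) {τ : ℝ} (hτ : τ ∈ Ioc 0 T) : 0 < gL τ :=
  lt_of_lt_of_le (by have := hτ.1; positivity) (h.linear_le_low hl (Ioc_subset_Icc_self hτ))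

/-- The square roots of a solution satisfy `x' = σL² / (2 x) + lL (y - x)`. -/
theorem IsODESolution.hasDerivAt_sqrt_low (h : IsODESolution σL σH lL lH T gL gH) (hσ : 0 < σL)
    (hl : 0 < lL) {τ : ℝ} (hτ : τ ∈ Ioo 0 T) :
    HasDerivAt (fun s => √(gL s)) (σL ^ 2 / (2 * √(gL τ)) + lL * (√(gH τ) - √(gL τ))) τ := by
  have hp := h.pos_low hσ hl (Ioo_subset_Ioc_self hτ)
  have hs : 0 < √(gL τ) := Real.sqrt_pos.2 hp
  convert (h.hasDerivAt_low hτ).sqrt hp.ne' using 1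
  rw [Real.sqrt_mul (h.nonneg_high τ (Ioo_subset_Icc_self hτ))]
  have : gL τ = √(gL τ) ^ 2 := (Real.sq_sqrt hp.le).symm
  field_simp
  nlinarith

/-- The weights `lH` and `lL` are chosen so that the coupling contributes a negative perfect square
to the derivative of the squared distance of the square roots. The singular terms contribute with
the same sign because `x ↦ 1 / x` decreases. -/
theorem IsODESolution.eqOn_low (h : IsODESolution σL σH lL lH T gL gH)
    (k : IsODESolution σL σH lL lH T KL KH) (hσL : 0 < σL) (hσH : 0 < σH)
    (hlL : 0 < lL) (hlH : 0 < lH) : EqOn KL gL (Icc 0 T) := by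
  have hanti : AntitoneOn (fun s => lH * (√(gL s) - √(KL s)) ^ 2 + lL * (√(gH s) - √(KH s)) ^ 2)
      (Icc 0 T) := by
    have hd : ∀ s ∈ Ioo 0 T, HasDerivAt
        (fun s => lH * (√(gL s) - √(KL s)) ^ 2 + lL * (√(gH s) - √(KH s)) ^ 2)
        (lH * (2 * (√(gL s) - √(KL s)) * ((σL ^ 2 / (2 * √(gL s)) + lL * (√(gH s) - √(gL s)))
            - (σL ^ 2 / (2 * √(KL s)) + lL * (√(KH s) - √(KL s)))))
          + lL * (2 * (√(gH s) - √(KH s)) * ((σH ^ 2 / (2 * √(gH s)) + lH * (√(gL s) - √(gH s)))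
            - (σH ^ 2 / (2 * √(KH s)) + lH * (√(KL s) - √(KH s)))))) s := by
      intro s hs
      have e1 := (((h.hasDerivAt_sqrt_low hσL hlL hs).sub
        (k.hasDerivAt_sqrt_low hσL hlL hs)).pow 2).const_mul lH
      have e2 := (((h.symm.hasDerivAt_sqrt_low hσH hlH hs).sub
        (k.symm.hasDerivAt_sqrt_low hσH hlH hs)).pow 2).const_mul lL
      convert! e1.add e2 using 1
      simp
    refine antitoneOn_of_deriv_nonpos (convex_Icc 0 T) ?_ ?_ ?_
    · have c1 := h.continuousOn_low.sqrt
      have c2 := k.continuousOn_low.sqrt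
      have c3 := h.symm.continuousOn_low.sqrt
      have c4 := k.symm.continuousOn_low.sqrt
      fun_prop
    · rw [interior_Icc]
      exact fun s hs => (hd s hs).differentiableAt.differentiableWithinAt
    · rw [interior_Icc]
      intro s hs
      rw [(hd s hs).deriv]
      have hs' := Ioo_subset_Ioc_self hs
      have x1 := Real.sqrt_pos.2 (h.pos_low hσL hlL hs')
      have x2 := Real.sqrt_pos.2 (k.pos_low hσL hlL hs')
      have y1 := Real.sqrt_pos.2 (h.symm.pos_low hσH hlH hs')
      have y2 := Real.sqrt_pos.2 (k.symm.pos_low hσH hlH hs')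
      generalize √(gL s) = a at *
      generalize √(KL s) = b at *
      generalize √(gH s) = c at *
      generalize √(KH s) = d at *
      have ab : (a - b) * (σL ^ 2 / (2 * a) - σL ^ 2 / (2 * b)) ≤ 0 := by
        have : (a - b) * (σL ^ 2 / (2 * a) - σL ^ 2 / (2 * b))
          = - (σL ^ 2 * (a - b) ^ 2 / (2 * a * b)) := by field_simp; ring
        rw [this]; exact neg_nonpos.2 (by positivity)
      have cd : (c - d) * (σH ^ 2 / (2 * c) - σH ^ 2 / (2 * d)) ≤ 0 := by
        have : (c - d) * (σH ^ 2 / (2 * c) - σH ^ 2 / (2 * d))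
          = - (σH ^ 2 * (c - d) ^ 2 / (2 * c * d)) := by field_simp; ring
        rw [this]; exact neg_nonpos.2 (by positivity)
      -- The weighted coupling terms add up to `-2` times this square.
      have e : 0 ≤ lL * lH * ((a - b) - (c - d)) ^ 2 := by positivity
      have f1 := mul_nonpos_of_nonneg_of_nonpos hlH.le ab
      have f2 := mul_nonpos_of_nonneg_of_nonpos hlL.le cd
      linarith
  intro τ hτ
  have h0 := hanti ⟨le_rfl, hτ.1.trans hτ.2⟩ hτ hτ.1
  simp only [h.initial_low, h.initial_high, k.initial_low, k.initial_high, sub_self] at h0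
  have h1 : (√(gL τ) - √(KL τ)) ^ 2 ≤ 0 := by
    have : 0 ≤ lL * (√(gH τ) - √(KH τ)) ^ 2 := by positivity
    by_contra hc
    push Not at hc
    have := mul_pos hlH hc
    linarith
  have h2 : √(gL τ) = √(KL τ) := by nlinarith [sq_nonneg (√(gL τ) - √(KL τ))]
  exact ((Real.sqrt_inj (h.nonneg_low τ hτ) (k.nonneg_low τ hτ)).1 h2).symm

/-- The solution of `f' = c + 2 l w - 2 l f`, `f(0) = 0`. -/
def linearFlow (l c : ℝ) (w : ℝ → ℝ) (τ : ℝ) : ℝ :=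
  Real.exp (-(2 * l * τ)) * ∫ s in (0 : ℝ)..τ, Real.exp (2 * l * s) * (c + 2 * l * w s)

theorem hasDerivAt_linearFlow (l c : ℝ) {w : ℝ → ℝ} (hw : Continuous w) (τ : ℝ) :
    HasDerivAt (linearFlow l c w) (c + 2 * l * w τ - 2 * l * linearFlow l c w τ) τ := by
  have h1 : HasDerivAt (fun s => Real.exp (-(2 * l * s)))
      (Real.exp (-(2 * l * τ)) * (-(2 * l * 1))) τ :=
    ((hasDerivAt_id τ).const_mul (2 * l)).neg.exp
  have hc : Continuous fun s => Real.exp (2 * l * s) * (c + 2 * l * w s) := by fun_prop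
  have h2 := intervalIntegral.integral_hasDerivAt_right (hc.intervalIntegrable 0 τ)
    (hc.stronglyMeasurableAtFilter _ _) hc.continuousAt
  convert! h1.mul h2 using 1
  have h3 : Real.exp (-(2 * l * τ)) * Real.exp (2 * l * τ) = 1 := by
    rw [← Real.exp_add]; simp
  rw [linearFlow]
  linear_combination (-(c + 2 * l * w τ)) * h3

theorem continuous_linearFlow (l c : ℝ) {w : ℝ → ℝ} (hw : Continuous w) :
    Continuous (linearFlow l c w) :=
  continuous_iff_continuousAt.2 fun τ => (hasDerivAt_linearFlow l c hw τ).continuousAt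

theorem linearFlow_mono {l c : ℝ} (hl : 0 ≤ l) {v w : ℝ → ℝ} (hv : Continuous v)
    (hw : Continuous w) {τ : ℝ} (hτ : 0 ≤ τ) (h : ∀ s, 0 ≤ s → v s ≤ w s) :
    linearFlow l c v τ ≤ linearFlow l c w τ := by
  refine mul_le_mul_of_nonneg_left ?_ (Real.exp_pos _).le
  refine intervalIntegral.integral_mono_on hτ (Continuous.intervalIntegrable (by fun_prop) _ _)
    (Continuous.intervalIntegrable (by fun_prop) _ _) fun s hs => ?_
  have := h s hs.1
  gcongr

theorem linearFlow_nonneg {l c : ℝ} (hl : 0 ≤ l) (hc : 0 ≤ c) {w : ℝ → ℝ} {τ : ℝ}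
    (hτ : 0 ≤ τ) (h : ∀ s, 0 ≤ s → 0 ≤ w s) : 0 ≤ linearFlow l c w τ := by
  refine mul_nonneg (Real.exp_pos _).le (intervalIntegral.integral_nonneg hτ fun s hs => ?_)
  have := h s hs.1
  positivity

/-- The line `K τ` is a fixed supersolution: feeding `w = K s` and `c = K` into the flow returns
exactly `K τ`. -/
theorem linearFlow_le {l c K : ℝ} (hl : 0 ≤ l) (hc : c ≤ K) {w : ℝ → ℝ} (hw : Continuous w)
    {τ : ℝ} (hτ : 0 ≤ τ) (h : ∀ s, 0 ≤ s → w s ≤ K * s) : linearFlow l c w τ ≤ K * τ := by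
  have hint : ∫ s in (0 : ℝ)..τ, Real.exp (2 * l * s) * (K + 2 * l * (K * s))
      = Real.exp (2 * l * τ) * (K * τ) := by
    rw [intervalIntegral.integral_eq_sub_of_hasDerivAt
      (f := fun s => Real.exp (2 * l * s) * (K * s)) (fun s _ => ?_)
      (Continuous.intervalIntegrable (by fun_prop) _ _)]
    · simp
    · have h1 : HasDerivAt (fun s => Real.exp (2 * l * s))
          (Real.exp (2 * l * s) * (2 * l * 1)) s := ((hasDerivAt_id s).const_mul (2 * l)).exp
      convert! h1.mul ((hasDerivAt_id s).const_mul K) using 1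
      simp only [id]
      ring
  have h3 : Real.exp (-(2 * l * τ)) * Real.exp (2 * l * τ) = 1 := by
    rw [← Real.exp_add]; simp
  calc linearFlow l c w τ
      ≤ Real.exp (-(2 * l * τ)) * ∫ s in (0 : ℝ)..τ,
          Real.exp (2 * l * s) * (K + 2 * l * (K * s)) := by
        refine mul_le_mul_of_nonneg_left ?_ (Real.exp_pos _).le
        refine intervalIntegral.integral_mono_on hτ
          (Continuous.intervalIntegrable (by fun_prop) _ _)
          (Continuous.intervalIntegrable (by fun_prop) _ _) fun s hs => ?_
        have := h s hs.1
        gcongr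
    _ = K * τ := by rw [hint, ← mul_assoc, h3, one_mul]

/-- Monotone iteration for the system, started from zero. -/
def odeIter (σL σH lL lH : ℝ) : ℕ → (ℝ → ℝ) × (ℝ → ℝ)
  | 0 => (fun _ => 0, fun _ => 0)
  | n + 1 =>
    (linearFlow lL (σL ^ 2) fun s =>
        √((odeIter σL σH lL lH n).2 s * (odeIter σL σH lL lH n).1 s),
      linearFlow lH (σH ^ 2) fun s =>
        √((odeIter σL σH lL lH n).2 s * (odeIter σL σH lL lH n).1 s))

theorem continuous_odeIter (σL σH lL lH : ℝ) (n : ℕ) :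
    Continuous (odeIter σL σH lL lH n).1 ∧ Continuous (odeIter σL σH lL lH n).2 := by
  induction n with
  | zero => exact ⟨continuous_const, continuous_const⟩
  | succ n ih =>
    have := (ih.2.mul ih.1).sqrt
    exact ⟨continuous_linearFlow _ _ this, continuous_linearFlow _ _ this⟩

theorem odeIter_nonneg (hlL : 0 < lL) (hlH : 0 < lH) (n : ℕ) {τ : ℝ} (hτ : 0 ≤ τ) :
    0 ≤ (odeIter σL σH lL lH n).1 τ ∧ 0 ≤ (odeIter σL σH lL lH n).2 τ := by
  cases n with
  | zero => exact ⟨le_rfl, le_rfl⟩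
  | succ n =>
    exact ⟨linearFlow_nonneg hlL.le (sq_nonneg _) hτ fun _ _ => Real.sqrt_nonneg _,
      linearFlow_nonneg hlH.le (sq_nonneg _) hτ fun _ _ => Real.sqrt_nonneg _⟩

/-- The geometric mean increases in both nonnegative arguments and the flow increases in its input,
so order is passed from one step to the next. -/
theorem odeIter_le_succ (hlL : 0 < lL) (hlH : 0 < lH) (n : ℕ) :
    ∀ τ, 0 ≤ τ → (odeIter σL σH lL lH n).1 τ ≤ (odeIter σL σH lL lH (n + 1)).1 τ ∧
      (odeIter σL σH lL lH n).2 τ ≤ (odeIter σL σH lL lH (n + 1)).2 τ := by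
  induction n with
  | zero => exact fun τ hτ => odeIter_nonneg hlL hlH 1 hτ
  | succ n ih =>
    intro τ hτ
    have c (k : ℕ) := ((continuous_odeIter σL σH lL lH k).2.mul
      (continuous_odeIter σL σH lL lH k).1).sqrt
    have key : ∀ s, 0 ≤ s → √((odeIter σL σH lL lH n).2 s * (odeIter σL σH lL lH n).1 s)
        ≤ √((odeIter σL σH lL lH (n + 1)).2 s * (odeIter σL σH lL lH (n + 1)).1 s) :=
      fun s hs => Real.sqrt_le_sqrt (mul_le_mul (ih s hs).2 (ih s hs).1
        (odeIter_nonneg hlL hlH n hs).1 (odeIter_nonneg hlL hlH (n + 1) hs).2)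
    exact ⟨linearFlow_mono hlL.le (c n) (c (n + 1)) hτ key,
      linearFlow_mono hlH.le (c n) (c (n + 1)) hτ key⟩

/-- The geometric mean of two functions below `σH² s` is again below `σH² s`, and both sources are
at most `σH²`. -/
theorem odeIter_le (hσL : 0 < σL) (hσ : σL < σH) (hlL : 0 < lL) (hlH : 0 < lH) (n : ℕ) :
    ∀ τ, 0 ≤ τ → (odeIter σL σH lL lH n).1 τ ≤ σH ^ 2 * τ ∧
      (odeIter σL σH lL lH n).2 τ ≤ σH ^ 2 * τ := by
  induction n with
  | zero => exact fun τ hτ => ⟨by simp only [odeIter]; positivity, by simp only [odeIter]; positivity⟩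
  | succ n ih =>
    intro τ hτ
    have c := ((continuous_odeIter σL σH lL lH n).2.mul (continuous_odeIter σL σH lL lH n).1).sqrt
    have key : ∀ s, 0 ≤ s → √((odeIter σL σH lL lH n).2 s * (odeIter σL σH lL lH n).1 s)
        ≤ σH ^ 2 * s := fun s hs => by
      refine Real.sqrt_le_iff.2 ⟨by positivity, ?_⟩
      rw [sq (σH ^ 2 * s)]
      exact mul_le_mul (ih s hs).2 (ih s hs).1 (odeIter_nonneg hlL hlH n hs).1 (by positivity)
    exact ⟨linearFlow_le hlL.le (by gcongr) c hτ key, linearFlow_le hlH.le le_rfl c hτ key⟩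

theorem tendsto_linearFlow {l c K : ℝ} {w : ℕ → ℝ → ℝ} {v : ℝ → ℝ} (hw : ∀ n, Continuous (w n))
    {τ : ℝ} (hτ : 0 ≤ τ) (hb : ∀ n s, 0 ≤ s → |w n s| ≤ K * s)
    (hlim : ∀ s, 0 ≤ s → Tendsto (fun n => w n s) atTop (𝓝 (v s))) :
    Tendsto (fun n => linearFlow l c (w n) τ) atTop (𝓝 (linearFlow l c v τ)) := by
  refine Tendsto.const_mul _ ?_
  refine intervalIntegral.tendsto_integral_filter_of_dominated_convergence
    (fun s => Real.exp (2 * l * s) * (|c| + |2 * l| * (K * s))) ?_ ?_ ?_ ?_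
  · refine Eventually.of_forall fun n => Continuous.aestronglyMeasurable ?_
    have := hw n
    fun_prop
  · refine Eventually.of_forall fun n => ae_of_all _ fun s hs => ?_
    rw [uIoc_of_le hτ] at hs
    rw [Real.norm_eq_abs, abs_mul, Real.abs_exp]
    refine mul_le_mul_of_nonneg_left ((abs_add_le _ _).trans ?_) (Real.exp_pos _).le
    rw [abs_mul]
    have := hb n s hs.1.le
    gcongr
  · exact Continuous.intervalIntegrable (by fun_prop) _ _
  · refine ae_of_all _ fun s hs => ?_
    rw [uIoc_of_le hτ] at hs
    exact ((((hlim s hs.1.le).const_mul (2 * l)).const_add c).const_mul _)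

/-- The increasing iterates converge pointwise and dominated convergence passes to the limit in the
integral equation. Regularity is then recovered from that equation: a bounded measurable coupling
gives a continuous limit, which gives a continuous coupling, which gives differentiability. -/
theorem exists_isODESolution (hσL : 0 < σL) (hσ : σL < σH) (hlL : 0 < lL) (hlH : 0 < lH)
    (hT : 0 < T) : ∃ gL gH : ℝ → ℝ, IsODESolution σL σH lL lH T gL gH := by
  set u := odeIter σL σH lL lH with hu
  let gL : ℝ → ℝ := fun τ => ⨆ n, (u n).1 τ
  let gH : ℝ → ℝ := fun τ => ⨆ n, (u n).2 τ
  have limL : ∀ τ, 0 ≤ τ → Tendsto (fun n => (u n).1 τ) atTop (𝓝 (gL τ)) := fun τ hτ =>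
    tendsto_atTop_ciSup (monotone_nat_of_le_succ fun n => (odeIter_le_succ hlL hlH n τ hτ).1)
      ⟨σH ^ 2 * τ, by rintro _ ⟨n, rfl⟩; exact (odeIter_le hσL hσ hlL hlH n τ hτ).1⟩
  have limH : ∀ τ, 0 ≤ τ → Tendsto (fun n => (u n).2 τ) atTop (𝓝 (gH τ)) := fun τ hτ =>
    tendsto_atTop_ciSup (monotone_nat_of_le_succ fun n => (odeIter_le_succ hlL hlH n τ hτ).2)
      ⟨σH ^ 2 * τ, by rintro _ ⟨n, rfl⟩; exact (odeIter_le hσL hσ hlL hlH n τ hτ).2⟩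
  have nnL : ∀ τ, 0 ≤ τ → 0 ≤ gL τ := fun τ hτ =>
    ge_of_tendsto' (limL τ hτ) fun n => (odeIter_nonneg hlL hlH n hτ).1
  have nnH : ∀ τ, 0 ≤ τ → 0 ≤ gH τ := fun τ hτ =>
    ge_of_tendsto' (limH τ hτ) fun n => (odeIter_nonneg hlL hlH n hτ).2
  have leL : ∀ τ, 0 ≤ τ → gL τ ≤ σH ^ 2 * τ := fun τ hτ =>
    le_of_tendsto' (limL τ hτ) fun n => (odeIter_le hσL hσ hlL hlH n τ hτ).1
  have leH : ∀ τ, 0 ≤ τ → gH τ ≤ σH ^ 2 * τ := fun τ hτ =>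
    le_of_tendsto' (limH τ hτ) fun n => (odeIter_le hσL hσ hlL hlH n τ hτ).2
  let w : ℕ → ℝ → ℝ := fun n s => √((u n).2 s * (u n).1 s)
  let v : ℝ → ℝ := fun s => √(gH s * gL s)
  have hw : ∀ n, Continuous (w n) := fun n =>
    ((continuous_odeIter σL σH lL lH n).2.mul (continuous_odeIter σL σH lL lH n).1).sqrt
  have sqrt_le {a b s : ℝ} (hs : 0 ≤ s) (ha : 0 ≤ a) (ha' : a ≤ σH ^ 2 * s)
      (hb' : b ≤ σH ^ 2 * s) : √(b * a) ≤ σH ^ 2 * s := by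
    refine Real.sqrt_le_iff.2 ⟨by positivity, ?_⟩
    rw [sq (σH ^ 2 * s)]
    exact mul_le_mul hb' ha' ha (by positivity)
  have hwb : ∀ n s, 0 ≤ s → |w n s| ≤ σH ^ 2 * s := fun n s hs => by
    rw [abs_of_nonneg (Real.sqrt_nonneg _)]
    exact sqrt_le hs (odeIter_nonneg hlL hlH n hs).1 (odeIter_le hσL hσ hlL hlH n s hs).1
      (odeIter_le hσL hσ hlL hlH n s hs).2
  have hvb : ∀ s, 0 ≤ s → |v s| ≤ σH ^ 2 * s := fun s hs => by
    rw [abs_of_nonneg (Real.sqrt_nonneg _)]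
    exact sqrt_le hs (nnL s hs) (leL s hs) (leH s hs)
  have hlim : ∀ s, 0 ≤ s → Tendsto (fun n => w n s) atTop (𝓝 (v s)) := fun s hs =>
    ((limH s hs).mul (limL s hs)).sqrt
  have eqL : ∀ τ, 0 ≤ τ → gL τ = linearFlow lL (σL ^ 2) v τ := fun τ hτ =>
    tendsto_nhds_unique ((tendsto_add_atTop_iff_nat 1).2 (limL τ hτ))
      (tendsto_linearFlow hw hτ hwb hlim)
  have eqH : ∀ τ, 0 ≤ τ → gH τ = linearFlow lH (σH ^ 2) v τ := fun τ hτ =>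
    tendsto_nhds_unique ((tendsto_add_atTop_iff_nat 1).2 (limH τ hτ))
      (tendsto_linearFlow hw hτ hwb hlim)
  have hvm : Measurable v := by
    have h1 : Measurable gL :=
      Measurable.iSup fun n => (continuous_odeIter σL σH lL lH n).1.measurable
    have h2 : Measurable gH :=
      Measurable.iSup fun n => (continuous_odeIter σL σH lL lH n).2.measurable
    exact (h2.mul h1).sqrt
  have hcont : ∀ l c, ContinuousOn (linearFlow l c v) (Icc 0 T) := by
    intro l c
    refine ContinuousOn.mul (by fun_prop) ?_
    refine intervalIntegral.continuousOn_primitive_interval' (b₁ := 0) (b₂ := T) ?_ (by simp) |>.mono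
      (by rw [uIcc_of_le hT.le])
    rw [intervalIntegrable_iff_integrableOn_Ioc_of_le hT.le]
    refine Measure.integrableOn_of_bounded (M := Real.exp (|2 * l| * T) *
      (|c| + |2 * l| * (σH ^ 2 * T))) (by simp) (by fun_prop) ?_
    refine (ae_restrict_mem measurableSet_Ioc).mono fun s hs => ?_
    rw [Real.norm_eq_abs, abs_mul, Real.abs_exp]
    have h1 : 2 * l * s ≤ |2 * l| * T :=
      mul_le_mul (le_abs_self _) hs.2 hs.1.le (abs_nonneg _)
    have h2 : |c + 2 * l * v s| ≤ |c| + |2 * l| * (σH ^ 2 * T) := by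
      refine (abs_add_le _ _).trans ?_
      rw [abs_mul (2 * l)]
      have := (hvb s hs.1.le).trans (mul_le_mul_of_nonneg_left hs.2 (sq_nonneg σH))
      gcongr
    gcongr
  have cv : ContinuousOn v (Icc 0 T) :=
    (((hcont lH (σH ^ 2)).congr fun τ hτ => eqH τ hτ.1).mul
      ((hcont lL (σL ^ 2)).congr fun τ hτ => eqL τ hτ.1)).sqrt
  -- A globally continuous extension, so that the two-sided derivative of the flow is available at
  -- the endpoints as well.
  let v' : ℝ → ℝ := IccExtend hT.le (Icc (0 : ℝ) T |>.domRestrict v)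
  have hv' : Continuous v' := cv.domRestrict.Icc_extend'
  have vv' : ∀ s ∈ Icc 0 T, v' s = v s := fun s hs => by
    simp only [v']; rw [IccExtend_of_mem _ _ hs]; rfl
  have flow_eq : ∀ l c, ∀ τ ∈ Icc 0 T, linearFlow l c v τ = linearFlow l c v' τ := by
    intro l c τ hτ
    unfold linearFlow
    congr 1
    refine intervalIntegral.integral_congr fun s hs => ?_
    rw [uIcc_of_le hτ.1] at hs
    simp only [vv' s ⟨hs.1, hs.2.trans hτ.2⟩]
  have deriv : ∀ l c (g : ℝ → ℝ), (∀ τ, 0 ≤ τ → g τ = linearFlow l c v τ) → ∀ τ ∈ Icc 0 T,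
      HasDerivWithinAt g (c + 2 * l * (√(gH τ * gL τ) - g τ)) (Icc 0 T) τ := by
    intro l c g hg τ hτ
    have h1 := (hasDerivAt_linearFlow l c hv' τ).hasDerivWithinAt (s := Icc 0 T)
    rw [vv' τ hτ, ← flow_eq l c τ hτ, ← hg τ hτ.1] at h1
    convert! h1.congr (fun s hs => (hg s hs.1).trans (flow_eq l c s hs))
      ((hg τ hτ.1).trans (flow_eq l c τ hτ)) using 1
    simp only [v]; ring
  exact ⟨gL, gH,
    { initial_low := by rw [eqL 0 le_rfl]; simp [linearFlow]
      initial_high := by rw [eqH 0 le_rfl]; simp [linearFlow]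
      nonneg_low := fun τ hτ => nnL τ hτ.1
      nonneg_high := fun τ hτ => nnH τ hτ.1
      deriv_low := deriv lL (σL ^ 2) gL eqL
      deriv_high := deriv lH (σH ^ 2) gH eqH }⟩

end ODE

/-! ### Pathwise analysis of an equation driven by two counting paths. -/

section Paths

theorem leftLim_eq_of_eqOn {f : ℝ → ℝ} {s r c : ℝ} (hsr : s < r) (h : ∀ x ∈ Ico s r, f x = c) :
    Function.leftLim f r = c := by
  refine leftLim_eq_of_tendsto (tendsto_const_nhds.congr' ?_)
  filter_upwards [Ioo_mem_nhdsLT hsr] with x hx using (h x ⟨hx.1.le, hx.2⟩).symm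

variable {N : ℝ → ℕ}

theorem eq_of_mem_Icc_of_eq (hN : MonotoneOn N (Ici 0)) {s r u : ℝ} (hs : 0 ≤ s)
    (hr : r ∈ Icc s u) (h : N u = N s) : N r = N s :=
  le_antisymm (h ▸ hN (hs.trans hr.1) (hs.trans (hr.1.trans hr.2)) hr.2)
    (hN hs (hs.trans hr.1) hr.1)

theorem jump_eq_zero (hN : MonotoneOn N (Ici 0)) {s u r : ℝ} (hs : 0 ≤ s) (hr : r ∈ Ioc s u)
    (h : N u = N s) : (N r : ℝ) - Function.leftLim (fun u => (N u : ℝ)) r = 0 := by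
  rw [eq_of_mem_Icc_of_eq hN hs (Ioc_subset_Icc_self hr) h, leftLim_eq_of_eqOn hr.1, sub_self]
  intro x hx
  rw [eq_of_mem_Icc_of_eq hN hs ⟨hx.1, hx.2.le.trans hr.2⟩ h]

/-- Distinct jump times have distinct values of `N`, all bounded by `N u`. -/
theorem finite_jumps (hN : MonotoneOn N (Ici 0)) {u : ℝ} :
    {r ∈ Ioc 0 u | (N r : ℝ) - Function.leftLim (fun u => (N u : ℝ)) r ≠ 0}.Finite := by
  refine Set.Finite.of_injOn (f := N) (t := Iic (N u)) (fun r hr => ?_) ?_ (finite_Iic _)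
  · exact hN hr.1.1.le (hr.1.1.le.trans hr.1.2) hr.1.2
  · intro r hr r' hr' h
    by_contra hne
    rcases lt_or_gt_of_ne hne with hlt | hlt
    · exact hr'.2 (jump_eq_zero hN hr.1.1.le ⟨hlt, le_rfl⟩ h.symm)
    · exact hr.2 (jump_eq_zero hN hr'.1.1.le ⟨hlt, le_rfl⟩ h)

theorem jumpIntegral_eq_of_eq (hN : MonotoneOn N (Ici 0)) (h : ℝ → ℝ) {s u : ℝ} (hs : 0 ≤ s)
    (hsu : s ≤ u) (heq : N u = N s) : jumpIntegral h N u = jumpIntegral h N s := by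
  refine finsum_mem_inter_support_eq' _ _ _ fun r hr => ⟨fun hr' => ⟨hr'.1, ?_⟩,
    fun hr' => ⟨hr'.1, hr'.2.trans hsu⟩⟩
  by_contra hc
  push Not at hc
  exact hr (by simp only [jump_eq_zero hN hs ⟨hc, hr'.2⟩ heq, mul_zero])

theorem exists_jump_time (hN : MonotoneOn N (Ici 0))
    (hNc : ∀ t, 0 ≤ t → ContinuousWithinAt N (Ici t) t) {s u : ℝ} (hs : 0 ≤ s) (hsu : s ≤ u)
    (hu : N u = N s + 1) :
    ∃ τ ∈ Ioc s u, (∀ r ∈ Ico s τ, N r = N s) ∧ ∀ r ∈ Icc τ u, N r = N s + 1 := by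
  set S := {r ∈ Icc s u | N r = N u} with hS
  have hbdd : BddBelow S := ⟨s, fun r hr => hr.1.1⟩
  have hne : S.Nonempty := ⟨u, ⟨hsu, le_rfl⟩, rfl⟩
  set τ := sInf S with hτ
  have hτs : s ≤ τ := le_csInf hne fun r hr => hr.1.1
  have hτu : τ ≤ u := csInf_le hbdd ⟨⟨hsu, le_rfl⟩, rfl⟩
  have hmono {x y : ℝ} (hx : s ≤ x) (hxy : x ≤ y) : N x ≤ N y :=
    hN (hs.trans hx) (hs.trans (hx.trans hxy)) hxy
  have hτN : N τ = N u := by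
    -- As `ℕ` is discrete, right continuity makes `N` constant just after `τ`; hence the infimum is
    -- attained.
    have hev : ∀ᶠ r in 𝓝[≥] τ, N r = N τ :=
      (hNc τ (hs.trans hτs)).eventually (by simp : ∀ᶠ n in 𝓝 (N τ), n = N τ)
    obtain ⟨v, hv, hv'⟩ := (mem_nhdsGE_iff_exists_Ico_subset' (lt_add_one τ)).1 hev
    obtain ⟨r, hr, hrv⟩ := exists_lt_of_csInf_lt hne hv
    rw [← hr.2]
    exact (hv' ⟨csInf_le hbdd hr, hrv⟩).symm
  have hlt : s < τ := lt_of_le_of_ne hτs fun h => by rw [← h] at hτN; omega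
  refine ⟨τ, ⟨hlt, hτu⟩, fun r hr => ?_, fun r hr => ?_⟩
  · have h1 : N r ≠ N u := fun h =>
      hr.2.not_ge (csInf_le hbdd ⟨⟨hr.1, hr.2.le.trans hτu⟩, h⟩)
    have h2 := hmono hr.1 (hr.2.le.trans hτu)
    have h3 := hmono le_rfl hr.1
    omega
  · have h2 := hmono (hτs.trans hr.1) hr.2
    have h3 := hmono hτs hr.1
    omega

theorem exists_jumpIntegral_eq_add (hN : MonotoneOn N (Ici 0))
    (hNc : ∀ t, 0 ≤ t → ContinuousWithinAt N (Ici t) t) (h : ℝ → ℝ) {s u : ℝ} (hs : 0 ≤ s)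
    (hsu : s ≤ u) (hu : N u = N s + 1) :
    ∃ τ ∈ Ioc s u, (∀ r ∈ Ico s τ, N r = N s) ∧
      jumpIntegral h N u = jumpIntegral h N s + Function.leftLim h τ := by
  obtain ⟨τ, hτ, hbefore, hafter⟩ := exists_jump_time hN hNc hs hsu hu
  refine ⟨τ, hτ, hbefore, ?_⟩
  have hjump : (N τ : ℝ) - Function.leftLim (fun u => (N u : ℝ)) τ = 1 := by
    rw [leftLim_eq_of_eqOn (c := N s) hτ.1 fun r hr => by rw [hbefore r hr],
      hafter τ ⟨le_rfl, hτ.2⟩]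
    push_cast; ring
  unfold jumpIntegral
  set f : ℝ → ℝ := fun r =>
    Function.leftLim h r * ((N r : ℝ) - Function.leftLim (fun u => (N u : ℝ)) r) with hf
  have hfin : (Ioc 0 u ∩ Function.support f).Finite :=
    (finite_jumps hN (u := u)).subset fun r hr => ⟨hr.1, right_ne_zero_of_mul hr.2⟩
  rw [← Ioc_union_Ioc_eq_Ioc hs hsu, finsum_mem_union'
    (disjoint_left.2 fun r hr hr' => hr.2.not_gt hr'.1)
    (hfin.subset (inter_subset_inter_left _ (Ioc_subset_Ioc_right hsu)))
    (hfin.subset (inter_subset_inter_left _ (Ioc_subset_Ioc_left hs)))]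
  congr 1
  rw [finsum_mem_inter_support_eq' f (Ioc s u) {τ}, finsum_mem_singleton]
  · simp only [hf, hjump, mul_one]
  · refine fun r hr => ⟨fun hr' => ?_, fun hr' => (mem_singleton_iff.1 hr') ▸ hτ⟩
    refine mem_singleton_iff.2 (by_contra fun hne => hr ?_)
    rcases lt_or_gt_of_ne hne with hlt | hlt
    · simp only [hf, jump_eq_zero hN hs ⟨hr'.1, le_rfl⟩ (hbefore r ⟨hr'.1.le, hlt⟩), mul_zero]
    · simp only [hf, jump_eq_zero hN (hs.trans hτ.1.le) ⟨hlt, hr'.2⟩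
        (hu.trans (hafter τ ⟨le_rfl, hτ.2⟩).symm), mul_zero]

variable {N₁ N₂ : ℝ → ℕ} {x : ℝ → ℝ} {a b : ℝ}

/-- A path that is driven by the counting paths `N₁` (towards `b`) and `N₂` (towards `a`). -/
def IsDriven (N₁ N₂ : ℝ → ℕ) (a b : ℝ) (x : ℝ → ℝ) : Prop :=
  ∀ t, 0 ≤ t → x t = x 0 + jumpIntegral (fun u => b - x u) N₁ t
    - jumpIntegral (fun u => x u - a) N₂ t

theorem IsDriven.eq_of_no_jump (hx : IsDriven N₁ N₂ a b x) (h₁ : MonotoneOn N₁ (Ici 0))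
    (h₂ : MonotoneOn N₂ (Ici 0)) {s u : ℝ} (hs : 0 ≤ s) (hsu : s ≤ u) (e₁ : N₁ u = N₁ s)
    (e₂ : N₂ u = N₂ s) : x u = x s := by
  rw [hx u (hs.trans hsu), hx s hs, jumpIntegral_eq_of_eq h₁ _ hs hsu e₁,
    jumpIntegral_eq_of_eq h₂ _ hs hsu e₂]

/-- Up to the single jump the path keeps its value `x s`, so the jump adds `b - x s` and lands at
`b`, whatever `x s` was. -/
theorem IsDriven.eq_of_up (hx : IsDriven N₁ N₂ a b x) (h₁ : MonotoneOn N₁ (Ici 0))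
    (h₂ : MonotoneOn N₂ (Ici 0)) (c₁ : ∀ t, 0 ≤ t → ContinuousWithinAt N₁ (Ici t) t)
    {s u : ℝ} (hs : 0 ≤ s) (hsu : s ≤ u) (e₁ : N₁ u = N₁ s + 1)
    (e₂ : N₂ u = N₂ s) : x u = b := by
  obtain ⟨τ, hτ, hb, hj⟩ := exists_jumpIntegral_eq_add h₁ c₁ (fun u => b - x u) hs hsu e₁
  have h := hx u (hs.trans hsu)
  rw [hj, jumpIntegral_eq_of_eq h₂ _ hs hsu e₂, leftLim_eq_of_eqOn (c := b - x s) hτ.1] at h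
  · have := hx s hs
    linarith
  · intro r hr
    rw [hx.eq_of_no_jump h₁ h₂ hs hr.1 (hb r hr)
      (eq_of_mem_Icc_of_eq h₂ hs ⟨hr.1, hr.2.le.trans hτ.2⟩ e₂)]

theorem IsDriven.eq_of_down (hx : IsDriven N₁ N₂ a b x) (h₁ : MonotoneOn N₁ (Ici 0))
    (h₂ : MonotoneOn N₂ (Ici 0)) (c₂ : ∀ t, 0 ≤ t → ContinuousWithinAt N₂ (Ici t) t)
    {s u : ℝ} (hs : 0 ≤ s) (hsu : s ≤ u) (e₁ : N₁ u = N₁ s)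
    (e₂ : N₂ u = N₂ s + 1) : x u = a := by
  obtain ⟨τ, hτ, hb, hj⟩ := exists_jumpIntegral_eq_add h₂ c₂ (fun u => x u - a) hs hsu e₂
  have h := hx u (hs.trans hsu)
  rw [hj, jumpIntegral_eq_of_eq h₁ _ hs hsu e₁, leftLim_eq_of_eqOn (c := x s - a) hτ.1] at h
  · have := hx s hs
    linarith
  · intro r hr
    rw [hx.eq_of_no_jump h₁ h₂ hs hr.1
      (eq_of_mem_Icc_of_eq h₁ hs ⟨hr.1, hr.2.le.trans hτ.2⟩ e₁) (hb r hr)]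

end Paths

/-! ### Short-time transition estimates and the forward equation. -/

section Transition

variable {Ω : Type*} [mΩ : MeasurableSpace Ω] {P : Measure Ω}
  {𝔽 : Filtration ℝ mΩ} {NL NH : ℝ → Ω → ℕ} {lL lH σL σH : ℝ} {σ : ℝ → Ω → ℝ}

/-- The event that the pair of increments over `(s, u]` is `(i, j)`. -/
def incrementEvent (NL NH : ℝ → Ω → ℕ) (s u : ℝ) (i j : ℕ) : Set Ω :=
  {ω | NL u ω - NL s ω = i ∧ NH u ω - NH s ω = j}

/-- The event that at most one jump occurs in `(s, u]`. -/
def atMostOneJump (NL NH : ℝ → Ω → ℕ) (s u : ℝ) : Set Ω :=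
  incrementEvent NL NH s u 0 0 ∪ (incrementEvent NL NH s u 1 0 ∪ incrementEvent NL NH s u 0 1)

theorem IsPoissonProcess.measurable {N : ℝ → Ω → ℕ} {r : ℝ} (hN : IsPoissonProcess P 𝔽 N r)
    {t : ℝ} (ht : 0 ≤ t) : Measurable (N t) := (hN.adapted t ht).mono (𝔽.le t) le_rfl

theorem IsVolatility.measurable (hvol : IsVolatility P 𝔽 NL NH σL σH σ) {t : ℝ} (ht : 0 ≤ t) :
    Measurable (σ t) := (hvol.adapted t ht).mono (𝔽.le t) le_rfl

theorem IsPoissonProcess.real_increment {N : ℝ → Ω → ℕ} {r : ℝ} (hN : IsPoissonProcess P 𝔽 N r)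
    {s u : ℝ} (hs : 0 ≤ s) (hsu : s ≤ u) (hr : 0 ≤ r) (i : ℕ) :
    P.real {ω | N u ω - N s ω = i} =
      Real.exp (-(r * (u - s))) * (r * (u - s)) ^ i / (i.factorial) := by
  have hm : Measurable fun ω => N u ω - N s ω :=
    (hN.measurable (hs.trans hsu)).sub (hN.measurable hs)
  have h : P.real {ω | N u ω - N s ω = i} = (P.map fun ω => N u ω - N s ω).real {i} := by
    rw [map_measureReal_apply hm (measurableSet_singleton i)]; rfl
  rw [h, hN.law s u hs hsu, poissonMeasure_real_singleton,
    Real.coe_toNNReal _ (mul_nonneg hr (sub_nonneg.2 hsu))]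

theorem IsIndepPoissonPair.measurableSet_incrementEvent (hN : IsIndepPoissonPair P 𝔽 NL NH lL lH)
    {s u : ℝ} (hs : 0 ≤ s) (hsu : s ≤ u) (i j : ℕ) :
    MeasurableSet (incrementEvent NL NH s u i j) := by
  have h1 : Measurable fun ω => NL u ω - NL s ω :=
    (hN.fst.measurable (hs.trans hsu)).sub (hN.fst.measurable hs)
  have h2 : Measurable fun ω => NH u ω - NH s ω :=
    (hN.snd.measurable (hs.trans hsu)).sub (hN.snd.measurable hs)
  exact (h1 (measurableSet_singleton i)).inter (h2 (measurableSet_singleton j))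

/-- This is all that is used of the stochastic equation: increments with at most one jump determine
the new state, and the others have quadratically small probability. -/
theorem IsVolatility.ae_transition (hvol : IsVolatility P 𝔽 NL NH σL σH σ)
    (hN : IsIndepPoissonPair P 𝔽 NL NH lL lH) {s u : ℝ} (hs : 0 ≤ s) (hsu : s ≤ u) :
    ∀ᵐ ω ∂P, (ω ∈ incrementEvent NL NH s u 0 0 → σ u ω = σ s ω) ∧
      (ω ∈ incrementEvent NL NH s u 1 0 → σ u ω = σH) ∧
      (ω ∈ incrementEvent NL NH s u 0 1 → σ u ω = σL) := by
  filter_upwards [hvol.sde] with ω hω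
  have hd : IsDriven (fun t => NL t ω) (fun t => NH t ω) σL σH fun t => σ t ω := hω
  have m1 := hN.fst.mono ω
  have m2 := hN.snd.mono ω
  have l1 : NL s ω ≤ NL u ω := m1 hs (hs.trans hsu) hsu
  have l2 : NH s ω ≤ NH u ω := m2 hs (hs.trans hsu) hsu
  refine ⟨fun h => hd.eq_of_no_jump m1 m2 hs hsu ?_ ?_,
    fun h => hd.eq_of_up m1 m2 (hN.fst.right_cont ω) hs hsu ?_ ?_,
    fun h => hd.eq_of_down m1 m2 (hN.snd.right_cont ω) hs hsu ?_ ?_⟩ <;>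
  · have := h.1
    have := h.2
    omega

theorem IsIndepPoissonPair.real_incrementEvent_inter (hN : IsIndepPoissonPair P 𝔽 NL NH lL lH)
    (hlL : 0 ≤ lL) (hlH : 0 ≤ lH) {s u : ℝ} (hs : 0 ≤ s) (hsu : s ≤ u) (i j : ℕ) {B : Set Ω}
    (hB : MeasurableSet[𝔽 s] B) :
    P.real (incrementEvent NL NH s u i j ∩ B) =
      Real.exp (-((lL + lH) * (u - s))) * ((lL * (u - s)) ^ i / (i.factorial))
        * ((lH * (u - s)) ^ j / (j.factorial)) * P.real B := by
  have h1 : P (incrementEvent NL NH s u i j ∩ B) = P (incrementEvent NL NH s u i j) * P B :=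
    (Indep_iff _ _ P).1 (hN.indep_past s u hs hsu) _ _
      ⟨{(i, j)}, measurableSet_singleton _, by ext; simp [incrementEvent]⟩ hB
  have h2 : P (incrementEvent NL NH s u i j) =
      P {ω | NL u ω - NL s ω = i} * P {ω | NH u ω - NH s ω = j} :=
    (hN.indep_incr s u hs hsu).measure_inter_preimage_eq_mul _ _ (measurableSet_singleton i)
      (measurableSet_singleton j)
  have h3 := hN.fst.real_increment hs hsu hlL i
  have h4 := hN.snd.real_increment hs hsu hlH j
  rw [measureReal_def] at h3 h4 ⊢
  rw [h1, h2, ENNReal.toReal_mul, ENNReal.toReal_mul, h3, h4, ← measureReal_def, add_mul, neg_add,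
    Real.exp_add]
  ring

variable [IsProbabilityMeasure P]

/-- With `x = (lL + lH) (u - s)` the probability is `1 - e^{-x} (1 + x)`, and `e^{-x} ≥ 1 - x`. -/
theorem IsIndepPoissonPair.real_compl_atMostOneJump_le
    (hN : IsIndepPoissonPair P 𝔽 NL NH lL lH) (hlL : 0 ≤ lL) (hlH : 0 ≤ lH) {s u : ℝ}
    (hs : 0 ≤ s) (hsu : s ≤ u) :
    P.real (atMostOneJump NL NH s u)ᶜ ≤ ((lL + lH) * (u - s)) ^ 2 := by
  have hm := hN.measurableSet_incrementEvent hs hsu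
  have hr (i j : ℕ) := hN.real_incrementEvent_inter hlL hlH hs hsu i j (B := univ) .univ
  simp only [inter_univ, probReal_univ, mul_one] at hr
  have hd1 : Disjoint (incrementEvent NL NH s u 1 0) (incrementEvent NL NH s u 0 1) :=
    disjoint_left.2 fun ω h h' => by have := h.1; have := h'.1; omega
  have hd0 : Disjoint (incrementEvent NL NH s u 0 0)
      (incrementEvent NL NH s u 1 0 ∪ incrementEvent NL NH s u 0 1) :=
    disjoint_left.2 fun ω h h' => by
      rcases h' with h' | h'
      · have := h.1; have := h'.1; omega
      · have := h.2; have := h'.2; omega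
  rw [atMostOneJump, probReal_compl_eq_one_sub ((hm 0 0).union ((hm 1 0).union (hm 0 1))),
    measureReal_union hd0 ((hm 1 0).union (hm 0 1)), measureReal_union hd1 (hm 0 1), hr, hr, hr]
  have hx : 0 ≤ (lL + lH) * (u - s) := mul_nonneg (add_nonneg hlL hlH) (sub_nonneg.2 hsu)
  have he := Real.add_one_le_exp (-((lL + lH) * (u - s)))
  simp only [pow_zero, pow_one, Nat.factorial_zero, Nat.factorial_one, Nat.cast_one, div_one,
    mul_one]
  nlinarith

/-- At every time the volatility almost surely takes one of its two values. -/
theorem IsVolatility.ae_two_states (hvol : IsVolatility P 𝔽 NL NH σL σH σ)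
    (hN : IsIndepPoissonPair P 𝔽 NL NH lL lH) (hlL : 0 ≤ lL) (hlH : 0 ≤ lH) {t : ℝ}
    (ht : 0 ≤ t) : ∀ᵐ ω ∂P, σ t ω = σL ∨ σ t ω = σH := by
  set q : ℝ → ℝ := fun s => P.real {ω | ¬ (σ s ω = σL ∨ σ s ω = σH)} with hq
  have hq0 : q 0 = 0 := by
    rw [hq, measureReal_eq_zero_iff]; exact hvol.initial
  -- A path in one of the two states can leave them only if at least two jumps occur in the
  -- interval.
  have step : ∀ s u, 0 ≤ s → s ≤ u → q u ≤ q s + ((lL + lH) * (u - s)) ^ 2 := by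
    intro s u hs hsu
    refine le_trans ?_ (add_le_add_right (hN.real_compl_atMostOneJump_le hlL hlH hs hsu) _)
    refine le_trans ?_ (measureReal_union_le _ _)
    refine ENNReal.toReal_mono (measure_ne_top _ _) (measure_mono_ae ?_)
    filter_upwards [hvol.ae_transition hN hs hsu] with ω hω h
    by_cases hc : ω ∈ atMostOneJump NL NH s u
    · rcases hc with h2 | h2 | h2
      · exact Or.inl fun h1 => h (by rw [hω.1 h2]; exact h1)
      · exact absurd (Or.inr (hω.2.1 h2)) h
      · exact absurd (Or.inl (hω.2.2 h2)) h
    · exact Or.inr hc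
  have iter : ∀ (d : ℝ), 0 ≤ d → ∀ k : ℕ, q (k * d) ≤ k * ((lL + lH) * d) ^ 2 := by
    intro d hd k
    induction k with
    | zero => simp [hq0]
    | succ k ih =>
      have := step (k * d) ((k + 1 : ℕ) * d) (by positivity) (by push_cast; nlinarith)
      have e : ((k + 1 : ℕ) * d - k * d) = d := by push_cast; ring
      rw [e] at this
      push_cast at this ⊢
      linarith
  have hle : q t ≤ 0 := by
    -- Splitting `[0, t]` into `n + 1` equal steps gives a total error of order `1 / (n + 1)`.
    have hlim : Tendsto (fun n : ℕ => ((lL + lH) * t) ^ 2 * (1 / ((n : ℝ) + 1))) atTop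
        (𝓝 (((lL + lH) * t) ^ 2 * 0)) := tendsto_one_div_add_atTop_nhds_zero_nat.const_mul _
    rw [mul_zero] at hlim
    refine ge_of_tendsto' hlim fun n => ?_
    have := iter (t / (n + 1)) (by positivity) (n + 1)
    have e : ((n + 1 : ℕ) : ℝ) * (t / (n + 1)) = t := by push_cast; field_simp
    rw [e] at this
    refine this.trans (le_of_eq ?_)
    push_cast
    field_simp
  have h0 : q t = 0 := le_antisymm hle measureReal_nonneg
  rw [hq, measureReal_eq_zero_iff] at h0
  exact h0

/-- Outside the event of two or more jumps, the state is high at `u` exactly when it was high at `s`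
and nothing jumped, or when only `NL` jumped. The factor `3` counts that exceptional event and the
first-order replacement of the exponential in each of the two main terms. -/
theorem IsVolatility.abs_real_high_sub_le (hvol : IsVolatility P 𝔽 NL NH σL σH σ)
    (hN : IsIndepPoissonPair P 𝔽 NL NH lL lH) (hlL : 0 ≤ lL) (hlH : 0 ≤ lH) (hσ : σL < σH)
    {s u : ℝ} (hs : 0 ≤ s) (hsu : s ≤ u) {A : Set Ω} (hA : MeasurableSet[𝔽 s] A) :
    |P.real (A ∩ {ω | σ u ω = σH}) - P.real (A ∩ {ω | σ s ω = σH})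
        - (u - s) * (lL * P.real A - (lL + lH) * P.real (A ∩ {ω | σ s ω = σH}))|
      ≤ 3 * (lL + lH) ^ 2 * (u - s) ^ 2 := by
  have hB : MeasurableSet[𝔽 s] (A ∩ {ω | σ s ω = σH}) :=
    hA.inter (hvol.adapted s hs (measurableSet_singleton σH))
  have e0 := hN.real_incrementEvent_inter hlL hlH hs hsu 0 0 hB
  have e1 := hN.real_incrementEvent_inter hlL hlH hs hsu 1 0 hA
  have hm := hN.measurableSet_incrementEvent hs hsu
  have hmA := 𝔽.le s _ hA
  have hbad := hN.real_compl_atMostOneJump_le hlL hlH hs hsu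
  have htr := hvol.ae_transition hN hs hsu
  simp only [pow_zero, pow_one, Nat.factorial_zero, Nat.factorial_one, Nat.cast_one, div_one,
    mul_one] at e0 e1
  have hdis : Disjoint (incrementEvent NL NH s u 0 0 ∩ (A ∩ {ω | σ s ω = σH}))
      (incrementEvent NL NH s u 1 0 ∩ A) :=
    disjoint_left.2 fun ω h h' => by have := h.1.1; have := h'.1.1; omega
  have hsum := measureReal_union (μ := P) hdis ((hm 1 0).inter hmA)
  have lower : P.real ((incrementEvent NL NH s u 0 0 ∩ (A ∩ {ω | σ s ω = σH})) ∪
      (incrementEvent NL NH s u 1 0 ∩ A)) ≤ P.real (A ∩ {ω | σ u ω = σH}) := by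
    refine ENNReal.toReal_mono (measure_ne_top _ _) (measure_mono_ae ?_)
    filter_upwards [htr] with ω hω h
    rcases h with h | h
    · exact ⟨h.2.1, (hω.1 h.1).trans h.2.2⟩
    · exact ⟨h.2, hω.2.1 h.1⟩
  have upper : P.real (A ∩ {ω | σ u ω = σH}) ≤
      P.real ((incrementEvent NL NH s u 0 0 ∩ (A ∩ {ω | σ s ω = σH})) ∪
      (incrementEvent NL NH s u 1 0 ∩ A)) + P.real (atMostOneJump NL NH s u)ᶜ := by
    refine le_trans ?_ (measureReal_union_le _ _)
    refine ENNReal.toReal_mono (measure_ne_top _ _) (measure_mono_ae ?_)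
    filter_upwards [htr] with ω hω h
    obtain ⟨hA', hu⟩ : ω ∈ A ∧ σ u ω = σH := h
    by_cases hc : ω ∈ atMostOneJump NL NH s u
    · rcases hc with h2 | h2 | h2
      · exact Or.inl (Or.inl ⟨h2, hA', (hω.1 h2).symm.trans hu⟩)
      · exact Or.inl (Or.inr ⟨h2, hA'⟩)
      · exact absurd ((hω.2.2 h2).symm.trans hu) hσ.ne
    · exact Or.inr hc
  rw [hsum, e0, e1] at lower upper
  have hp1 : P.real (A ∩ {ω | σ s ω = σH}) ≤ 1 := measureReal_le_one
  have hp0 : 0 ≤ P.real (A ∩ {ω | σ s ω = σH}) := measureReal_nonneg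
  have hA1 : P.real A ≤ 1 := measureReal_le_one
  have hA0 : 0 ≤ P.real A := measureReal_nonneg
  have hd : 0 ≤ u - s := sub_nonneg.2 hsu
  generalize P.real (A ∩ {ω | σ s ω = σH}) = p at *
  generalize P.real (A ∩ {ω | σ u ω = σH}) = p' at *
  generalize P.real A = r at *
  set d := u - s
  set x := (lL + lH) * d with hx
  have hx0 : 0 ≤ x := by positivity
  have hE1 := Real.add_one_le_exp (-x)
  -- This is `e^{-x} ≤ 1 / (1 + x) ≤ 1 - x + x²`.
  have hE2 : Real.exp (-x) ≤ 1 - x + x ^ 2 := by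
    have h := Real.add_one_le_exp x
    have hpos := Real.exp_pos (-x)
    have hm : Real.exp (-x) * Real.exp x = 1 := by rw [← Real.exp_add]; simp
    have : Real.exp (-x) * (1 + x) ≤ 1 := by nlinarith
    have h3 : (1 - x + x ^ 2) * (1 + x) = 1 + x ^ 3 := by ring
    have h4 : 0 ≤ x ^ 3 := by positivity
    by_contra hc
    push Not at hc
    nlinarith
  have hE3 : Real.exp (-x) ≤ 1 := Real.exp_le_one_iff.2 (by linarith)
  generalize Real.exp (-x) = E at *
  have hα : 0 ≤ lL * d := by positivity
  have hαx : lL * d ≤ x := by rw [hx]; nlinarith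
  have k1 : |(E - 1 + x) * p| ≤ x ^ 2 := by
    rw [abs_mul, abs_of_nonneg hp0, abs_of_nonneg (by linarith : 0 ≤ E - 1 + x)]
    nlinarith
  have k2 : |(lL * d) * (E - 1) * r| ≤ x ^ 2 := by
    rw [abs_mul, abs_mul, abs_of_nonneg hA0, abs_of_nonneg hα, abs_of_nonpos (by linarith)]
    have : lL * d * -(E - 1) ≤ x * x := mul_le_mul hαx (by linarith) (by linarith) hx0
    nlinarith
  rw [abs_le] at k1 k2 ⊢
  have e : 3 * (lL + lH) ^ 2 * d ^ 2 = 3 * x ^ 2 := by rw [hx]; ring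
  rw [e]
  have e' : d * (lL * r - (lL + lH) * p) = lL * d * r - x * p := by rw [hx]; ring
  rw [e']
  constructor <;> nlinarith

/-- A function with a quadratic forward error estimate solves the linear equation. -/
theorem hasDerivWithinAt_of_abs_sub_le {p : ℝ → ℝ} {a b C t₀ : ℝ} (hb : 0 ≤ b) (hC : 0 ≤ C)
    (hp : ∀ s, |p s| ≤ 1)
    (h : ∀ s u, t₀ ≤ s → s ≤ u → |p u - p s - (u - s) * (a - b * p s)| ≤ C * (u - s) ^ 2)
    {s : ℝ} (hs : t₀ ≤ s) : HasDerivWithinAt p (a - b * p s) (Ici t₀) s := by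
  rw [hasDerivWithinAt_iff_isLittleO]
  refine Asymptotics.IsBigO.trans_isLittleO (g := fun u => ‖u - s‖ ^ 2) ?_
    ((Asymptotics.isLittleO_pow_sub_sub s one_lt_two).mono nhdsWithin_le_nhds)
  refine Asymptotics.IsBigO.of_bound (C + b * (|a| + b + C)) ?_
  have hball : ∀ᶠ u in 𝓝[Ici t₀] s, |u - s| ≤ 1 := by
    refine nhdsWithin_le_nhds ?_
    filter_upwards [Metric.closedBall_mem_nhds s one_pos] with u hu
    simpa [Real.dist_eq] using hu
  filter_upwards [hball, self_mem_nhdsWithin] with u hu1 hu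
  rw [norm_pow, norm_norm, Real.norm_eq_abs, Real.norm_eq_abs, sq_abs, smul_eq_mul]
  have hK : 0 ≤ b * (|a| + b + C) := by positivity
  rcases le_total s u with hsu | hsu
  · refine (h s u hs hsu).trans (mul_le_mul_of_nonneg_right (by linarith) (sq_nonneg _))
  -- To the left of `s` the estimate starts from `u`. Replacing `p u` by `p s` in the rate costs
  -- another quadratic term, by the Lipschitz bound `h2` that the estimate itself supplies.
  · have h1 := h u s hu hsu
    have hd0 : 0 ≤ s - u := sub_nonneg.2 hsu
    have hd1 : s - u ≤ 1 := by rw [abs_sub_comm, abs_of_nonneg hd0] at hu1; exact hu1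
    have hr : |a - b * p u| ≤ |a| + b := by
      refine (abs_sub _ _).trans ?_
      rw [abs_mul, abs_of_nonneg hb]
      have := mul_le_mul_of_nonneg_left (hp u) hb
      linarith
    have h2 : |p s - p u| ≤ (s - u) * (|a| + b + C) := by
      have e : p s - p u = (p s - p u - (s - u) * (a - b * p u)) + (s - u) * (a - b * p u) := by
        ring
      rw [e]
      refine (abs_add_le _ _).trans ?_
      rw [abs_mul, abs_of_nonneg hd0]
      have := mul_le_mul_of_nonneg_left hr hd0
      have : C * (s - u) ^ 2 ≤ C * (s - u) := by
        refine mul_le_mul_of_nonneg_left ?_ hC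
        nlinarith
      linarith
    have e : p u - p s - (u - s) * (a - b * p s) =
        -(p s - p u - (s - u) * (a - b * p u)) - (s - u) * (b * (p s - p u)) := by ring
    rw [e]
    refine (abs_sub _ _).trans ?_
    rw [abs_neg, abs_mul, abs_mul, abs_of_nonneg hd0, abs_of_nonneg hb]
    have := mul_le_mul_of_nonneg_left (mul_le_mul_of_nonneg_left h2 hb) hd0
    nlinarith

/-- The forward equation for the probability of the high state on a past event. -/
theorem IsVolatility.hasDerivWithinAt_real_high (hvol : IsVolatility P 𝔽 NL NH σL σH σ)
    (hN : IsIndepPoissonPair P 𝔽 NL NH lL lH) (hlL : 0 ≤ lL) (hlH : 0 ≤ lH) (hσ : σL < σH)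
    {t s : ℝ} (ht : 0 ≤ t) (hts : t ≤ s) {A : Set Ω} (hA : MeasurableSet[𝔽 t] A) :
    HasDerivWithinAt (fun s => P.real (A ∩ {ω | σ s ω = σH}))
      (lL * P.real A - (lL + lH) * P.real (A ∩ {ω | σ s ω = σH})) (Ici t) s :=
  hasDerivWithinAt_of_abs_sub_le (by positivity) (C := 3 * (lL + lH) ^ 2) (by positivity)
    (fun _ => by rw [abs_of_nonneg measureReal_nonneg]; exact measureReal_le_one)
    (fun s u hs hsu => hvol.abs_real_high_sub_le hN hlL hlH hσ (ht.trans hs) hsu (𝔽.mono hs _ hA))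
    hts

end Transition

/-! ### Uniqueness for backward equations with a dissipative driver. -/

section Uniqueness

variable {Ω : Type*} [mΩ : MeasurableSpace Ω] {P : Measure Ω}

/-- The square of an integral is twice the iterated integral over the ordered pairs. -/
theorem sq_integral_eq_two_mul {f : ℝ → ℝ} {t T : ℝ} (ht : t ≤ T)
    (hf : IntegrableOn f (Ioc t T)) :
    (∫ u in t..T, f u) ^ 2 = 2 * ∫ s in t..T, f s * ∫ u in s..T, f u := by
  set ν := volume.restrict (Ioc t T) with hν
  have hprod : Integrable (fun p : ℝ × ℝ => f p.1 * f p.2) (ν.prod ν) := Integrable.mul_prod hf hf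
  have hlt : MeasurableSet {p : ℝ × ℝ | p.1 < p.2} := measurableSet_lt measurable_fst measurable_snd
  have hgt : MeasurableSet {p : ℝ × ℝ | p.2 < p.1} := measurableSet_lt measurable_snd measurable_fst
  have hi1 := hprod.indicator hlt
  have hi2 := hprod.indicator hgt
  have hswap : ∫ p, {p : ℝ × ℝ | p.2 < p.1}.indicator (fun p : ℝ × ℝ => f p.1 * f p.2) p ∂(ν.prod ν)
      = ∫ p, {p : ℝ × ℝ | p.1 < p.2}.indicator (fun p : ℝ × ℝ => f p.1 * f p.2) p ∂(ν.prod ν) := by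
    rw [← integral_prod_swap]
    refine integral_congr_ae (ae_of_all _ fun p => ?_)
    simp only [indicator, mem_ofPred_eq, Prod.fst_swap, Prod.snd_swap, mul_comm]
  have hsplit : ∫ p, f p.1 * f p.2 ∂(ν.prod ν) =
      ∫ p, {p : ℝ × ℝ | p.1 < p.2}.indicator (fun p : ℝ × ℝ => f p.1 * f p.2) p ∂(ν.prod ν) +
      ∫ p, {p : ℝ × ℝ | p.2 < p.1}.indicator (fun p : ℝ × ℝ => f p.1 * f p.2) p ∂(ν.prod ν) := by
    rw [← integral_add hi1 hi2, integral_prod _ hprod]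
    refine Eq.trans ?_ (integral_prod _ (hi1.add hi2)).symm
    refine integral_congr_ae (ae_of_all _ fun s => integral_congr_ae ?_)
    -- The diagonal is null, so the two strict orderings cover almost every pair.
    have : ∀ᵐ u ∂ν, u ≠ s := ae_restrict_of_ae (Measure.ae_ne volume s)
    filter_upwards [this] with u hu
    rcases lt_or_gt_of_ne hu with h | h
    · simp [indicator, h, h.le]
    · simp [indicator, h, h.le]
  have hord : ∫ p, {p : ℝ × ℝ | p.1 < p.2}.indicator (fun p : ℝ × ℝ => f p.1 * f p.2) p ∂(ν.prod ν)
      = ∫ s in t..T, f s * ∫ u in s..T, f u := by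
    rw [integral_prod _ hi1, intervalIntegral.integral_of_le ht]
    refine setIntegral_congr_fun measurableSet_Ioc fun s hs => ?_
    have e : (fun u => {p : ℝ × ℝ | p.1 < p.2}.indicator (fun p : ℝ × ℝ => f p.1 * f p.2) (s, u))
        = (Ioi s).indicator fun u => f s * f u := rfl
    rw [e, integral_indicator measurableSet_Ioi, Measure.restrict_restrict measurableSet_Ioi,
      inter_comm, Ioc_inter_Ioi, max_eq_right hs.1.le, integral_const_mul,
      intervalIntegral.integral_of_le hs.2]
  have hfub : ∫ p, f p.1 * f p.2 ∂(ν.prod ν) = (∫ u in t..T, f u) ^ 2 := by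
    rw [integral_prod_mul f f, intervalIntegral.integral_of_le ht, sq]
  rw [← hfub, hsplit, hswap, hord]
  ring

/-- If `P[Y | m] ≤ C` then `∫ h Y ≤ C ∫ h` for nonnegative `m`-measurable `h`. -/
theorem lintegral_mul_le_of_condExp_le [IsFiniteMeasure P] {m : MeasurableSpace Ω} (hm : m ≤ mΩ)
    {h Y : Ω → ℝ} {C : ℝ} (hh : Measurable[m] h) (hY : Integrable Y P) (hY0 : 0 ≤ᵐ[P] Y)
    (hC : P[Y | m] ≤ᵐ[P] fun _ => C) :
    ∫⁻ ω, ENNReal.ofReal (h ω) * ENNReal.ofReal (Y ω) ∂P ≤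
      ENNReal.ofReal C * ∫⁻ ω, ENNReal.ofReal (h ω) ∂P := by
  -- The conditional bound becomes a comparison of measures on `m`, which needs no integrability of
  -- `h` or of `h Y`.
  have hle : (P.withDensity fun ω => ENNReal.ofReal (Y ω)).trim hm ≤
      ENNReal.ofReal C • P.trim hm := by
    refine Measure.le_iff.2 fun A hA => ?_
    rw [trim_measurableSet_eq hm hA, withDensity_apply _ (hm A hA), Measure.smul_apply,
      trim_measurableSet_eq hm hA,
      ← ofReal_integral_eq_lintegral_ofReal hY.integrableOn (ae_restrict_of_ae hY0),
      ← setIntegral_condExp hm hY hA, smul_eq_mul]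
    have h1 : ∫ ω in A, (P[Y | m]) ω ∂P ≤ C * P.real A := by
      refine (setIntegral_mono_ae integrable_condExp.integrableOn (integrable_const C).integrableOn
        hC).trans (le_of_eq ?_)
      rw [setIntegral_const, smul_eq_mul, mul_comm]
    refine (ENNReal.ofReal_le_ofReal h1).trans ?_
    rw [ENNReal.ofReal_mul' measureReal_nonneg, ofReal_measureReal]
  have hhm : Measurable[m] fun ω => ENNReal.ofReal (h ω) := ENNReal.measurable_ofReal.comp hh
  calc ∫⁻ ω, ENNReal.ofReal (h ω) * ENNReal.ofReal (Y ω) ∂P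
      = ∫⁻ ω, ENNReal.ofReal (h ω) ∂(P.withDensity fun ω => ENNReal.ofReal (Y ω)) := by
        rw [lintegral_withDensity_eq_lintegral_mul₀ hY.1.aemeasurable.ennreal_ofReal
          (hhm.mono hm le_rfl).aemeasurable]
        simp only [Pi.mul_apply, mul_comm]
    _ = ∫⁻ ω, ENNReal.ofReal (h ω) ∂((P.withDensity fun ω => ENNReal.ofReal (Y ω)).trim hm) :=
        (lintegral_trim hm hhm).symm
    _ ≤ ∫⁻ ω, ENNReal.ofReal (h ω) ∂(ENNReal.ofReal C • P.trim hm) := lintegral_mono' hle le_rfl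
    _ = ENNReal.ofReal C * ∫⁻ ω, ENNReal.ofReal (h ω) ∂P := by
        rw [lintegral_smul_measure, lintegral_trim hm hhm, smul_eq_mul]

/-- Moving the endpoint `s` into an indicator leaves one fixed measure, so that joint measurability
in `s` and Fubini apply. -/
theorem intervalIntegral_eq_integral_indicator (f : ℝ → ℝ) {s T : ℝ} (hs : s ∈ Icc 0 T) :
    ∫ u in s..T, f u = ∫ u, (Ioi s).indicator f u ∂(volume.restrict (Ioc 0 T)) := by
  rw [intervalIntegral.integral_of_le hs.2, integral_indicator measurableSet_Ioi,
    Measure.restrict_restrict measurableSet_Ioi, inter_comm, Ioc_inter_Ioi, max_eq_right hs.1]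

/-- The tail integrals `∫_s^T f_u du` of a process. -/
def tailIntegral (T : ℝ) (f : ℝ → Ω → ℝ) (s : ℝ) (ω : Ω) : ℝ :=
  ∫ u, (Ioi s).indicator (fun u => f u ω) u ∂(volume.restrict (Ioc 0 T))

theorem measurable_tailIntegral {T : ℝ} {f : ℝ → Ω → ℝ} (hf : Measurable fun p : ℝ × Ω => f p.1 p.2) :
    Measurable fun p : ℝ × Ω => tailIntegral T f p.1 p.2 := by
  have hm : Measurable fun q : (ℝ × Ω) × ℝ => (Ioi q.1.1).indicator (fun u => f u q.1.2) q.2 := by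
    have hset : MeasurableSet {q : (ℝ × Ω) × ℝ | q.1.1 < q.2} :=
      measurableSet_lt (by fun_prop) (by fun_prop)
    exact (hf.comp (g := fun p : ℝ × Ω => f p.1 p.2)
      (f := fun q : (ℝ × Ω) × ℝ => (q.2, q.1.2)) (by fun_prop)).indicator hset
  exact hm.stronglyMeasurable.integral_prod_right'.measurable


theorem abs_tailIntegral_le {Ω : Type*} {T : ℝ} {f h : ℝ → Ω → ℝ} (hfh : ∀ t ω, |f t ω| ≤ h t ω) {s : ℝ} {ω : Ω}
    (hh : IntegrableOn (fun u => h u ω) (Ioc 0 T)) :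
    |tailIntegral T f s ω| ≤ tailIntegral T h s ω := by
  refine (norm_integral_le_integral_norm (μ := volume.restrict (Ioc 0 T))
    ((Ioi s).indicator fun u => f u ω)).trans ?_
  refine integral_mono_of_nonneg (ae_of_all _ fun _ => norm_nonneg _)
    (hh.indicator measurableSet_Ioi) (ae_of_all _ fun u => ?_)
  simp only [norm_indicator_eq_indicator_norm]
  exact indicator_le_indicator (hfh u ω)

/-- A backward equation with a dissipative driver has at most one bounded solution. -/
theorem ae_eq_of_backward_eq [IsProbabilityMeasure P] {T C : ℝ} {m : ℝ → MeasurableSpace Ω}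
    (hm : ∀ t ∈ Icc 0 T, m t ≤ mΩ) {a b X Y : ℝ → Ω → ℝ}
    (ha : Measurable fun p : ℝ × Ω => a p.1 p.2) (hb : Measurable fun p : ℝ × Ω => b p.1 p.2)
    (ha0 : ∀ t ω, 0 ≤ a t ω) (hb0 : ∀ t ω, 0 ≤ b t ω)
    (ham : ∀ t ∈ Icc 0 T, Measurable[m t] (a t)) (hbm : ∀ t ∈ Icc 0 T, Measurable[m t] (b t))
    (hai : Integrable (fun p : ℝ × Ω => a p.1 p.2) ((volume.restrict (Ioc 0 T)).prod P))
    (hbi : Integrable (fun p : ℝ × Ω => b p.1 p.2) ((volume.restrict (Ioc 0 T)).prod P))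
    (hX : ∀ t ∈ Icc 0 T, X t =ᵐ[P] P[fun ω => ∫ s in t..T, a s ω | m t])
    (hY : ∀ t ∈ Icc 0 T, Y t =ᵐ[P] P[fun ω => ∫ s in t..T, b s ω | m t])
    (hXC : ∀ t ∈ Icc 0 T, ∀ᵐ ω ∂P, X t ω ≤ C) (hYC : ∀ t ∈ Icc 0 T, ∀ᵐ ω ∂P, Y t ω ≤ C)
    (hdiss : ∀ t ∈ Ico 0 T, ∀ᵐ ω ∂P, (a t ω - b t ω) * (X t ω - Y t ω) ≤ 0) :
    ∀ t ∈ Icc 0 T, X t =ᵐ[P] Y t := by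
  set μ := volume.restrict (Ioc 0 T) with hμ
  set f : ℝ → Ω → ℝ := fun t ω => a t ω - b t ω with hf
  set h : ℝ → Ω → ℝ := fun t ω => a t ω + b t ω with hh
  have hfm : Measurable fun p : ℝ × Ω => f p.1 p.2 := ha.sub hb
  have hhm : Measurable fun p : ℝ × Ω => h p.1 p.2 := ha.add hb
  have hh0 : ∀ t ω, 0 ≤ h t ω := fun t ω => add_nonneg (ha0 t ω) (hb0 t ω)
  have hhi : Integrable (fun p : ℝ × Ω => h p.1 p.2) (μ.prod P) := hai.add hbi
  have hfh : ∀ t ω, |f t ω| ≤ h t ω := fun t ω =>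
    abs_le.2 ⟨by simp only [hf, hh]; linarith [ha0 t ω], by simp only [hf, hh]; linarith [hb0 t ω]⟩
  have hamem : ∀ᵐ s ∂μ, s ∈ Icc 0 T :=
    (ae_restrict_mem measurableSet_Ioc).mono fun s hs => Ioc_subset_Icc_self hs
  -- Dissipativity is assumed only before `T`; the single time `T` is null.
  have hamem' : ∀ᵐ s ∂μ, s ∈ Ico 0 T := by
    filter_upwards [hamem, ae_restrict_of_ae (Measure.ae_ne volume T)] with s hs hs'
    exact ⟨hs.1, lt_of_le_of_ne hs.2 hs'⟩
  have tail_int : ∀ {g : ℝ → Ω → ℝ}, Integrable (fun p : ℝ × Ω => g p.1 p.2) (μ.prod P) →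
      ∀ s, Integrable (tailIntegral T g s) P := by
    intro g hg s
    have : Integrable (fun p : ℝ × Ω => (Ioi s).indicator (fun u => g u p.2) p.1) (μ.prod P) :=
      hg.indicator (s := {p : ℝ × Ω | s < p.1}) (measurableSet_lt measurable_const measurable_fst)
    exact this.integral_prod_right
  have tail_eq : ∀ (g : ℝ → Ω → ℝ) (s), s ∈ Icc 0 T →
      tailIntegral T g s = fun ω => ∫ u in s..T, g u ω := fun g s hs => funext fun ω =>
    (intervalIntegral_eq_integral_indicator (fun u => g u ω) hs).symm
  have tail_add : ∀ (c d : ℝ → Ω → ℝ), Integrable (fun p : ℝ × Ω => c p.1 p.2) (μ.prod P) →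
      Integrable (fun p : ℝ × Ω => d p.1 p.2) (μ.prod P) → ∀ s,
      tailIntegral T (fun t ω => c t ω + d t ω) s =ᵐ[P] tailIntegral T c s + tailIntegral T d s := by
    intro c d hc hd s
    filter_upwards [hc.prod_left_ae, hd.prod_left_ae] with ω h1 h2
    simp only [tailIntegral, Pi.add_apply, indicator_add]
    exact integral_add (h1.indicator measurableSet_Ioi) (h2.indicator measurableSet_Ioi)
  have condAdd : ∀ s ∈ Icc 0 T, P[tailIntegral T h s | m s] =ᵐ[P] X s + Y s := by
    intro s hs
    have hX' := hX s hs
    have hY' := hY s hs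
    rw [← tail_eq a s hs] at hX'
    rw [← tail_eq b s hs] at hY'
    exact ((condExp_congr_ae (tail_add a b hai hbi s)).trans
      (condExp_add (tail_int hai s) (tail_int hbi s) _)).trans (hX'.symm.add hY'.symm)
  have condSub : ∀ s ∈ Icc 0 T, P[tailIntegral T f s | m s] =ᵐ[P] X s - Y s := by
    intro s hs
    have hX' := hX s hs
    have hY' := hY s hs
    rw [← tail_eq a s hs] at hX'
    rw [← tail_eq b s hs] at hY'
    have e : tailIntegral T f s =ᵐ[P] tailIntegral T a s - tailIntegral T b s := by
      filter_upwards [hai.prod_left_ae, hbi.prod_left_ae] with ω h1 h2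
      simp only [tailIntegral, Pi.sub_apply, hf, indicator_sub]
      exact integral_sub (h1.indicator measurableSet_Ioi) (h2.indicator measurableSet_Ioi)
    exact ((condExp_congr_ae e).trans
      (condExp_sub (tail_int hai s) (tail_int hbi s) _)).trans (hX'.symm.sub hY'.symm)
  have tail_nonneg : ∀ s ω, 0 ≤ tailIntegral T h s ω := fun s ω =>
    integral_nonneg fun u => indicator_nonneg (fun u _ => hh0 u ω) u
  -- The upper bounds on `X` and `Y` enter here: the conditional mean of the tail is `X s + Y s ≤ 2
  -- C`, so the product has integral at most `2 C` times that of `h`.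
  have hhY : Integrable (fun p : ℝ × Ω => h p.1 p.2 * tailIntegral T h p.1 p.2) (μ.prod P) := by
    refine ⟨(hhm.mul (measurable_tailIntegral hhm)).aestronglyMeasurable, ?_⟩
    rw [hasFiniteIntegral_iff_ofReal (ae_of_all _ fun p => mul_nonneg (hh0 _ _) (tail_nonneg _ _)),
      lintegral_prod (fun p : ℝ × Ω => ENNReal.ofReal (h p.1 p.2 * tailIntegral T h p.1 p.2))
        (hhm.mul (measurable_tailIntegral hhm)).ennreal_ofReal.aemeasurable]
    have hfin := hhi.2
    rw [hasFiniteIntegral_iff_ofReal (ae_of_all _ fun p => hh0 _ _),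
      lintegral_prod _ hhm.ennreal_ofReal.aemeasurable] at hfin
    refine lt_of_le_of_lt ?_ (ENNReal.mul_lt_top (a := ENNReal.ofReal (C + C))
      ENNReal.ofReal_lt_top hfin)
    rw [← lintegral_const_mul' _ _ ENNReal.ofReal_ne_top]
    refine lintegral_mono_ae ?_
    filter_upwards [hamem] with s hs
    simp only [ENNReal.ofReal_mul (hh0 _ _)]
    refine lintegral_mul_le_of_condExp_le (hm s hs) ((ham s hs).add (hbm s hs)) (tail_int hhi s)
      (ae_of_all _ (tail_nonneg s)) ?_
    filter_upwards [condAdd s hs, hXC s hs, hYC s hs] with ω h1 h2 h3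
    rw [h1]
    exact add_le_add h2 h3
  have hfY : Integrable (fun p : ℝ × Ω => f p.1 p.2 * tailIntegral T f p.1 p.2) (μ.prod P) := by
    refine hhY.mono' (hfm.mul (measurable_tailIntegral hfm)).aestronglyMeasurable ?_
    have hae : ∀ᵐ p ∂(μ.prod P), IntegrableOn (fun u => h u p.2) (Ioc 0 T) :=
      Measure.quasiMeasurePreserving_snd.ae hhi.prod_left_ae
    filter_upwards [hae] with p hp
    rw [Real.norm_eq_abs, abs_mul]
    exact mul_le_mul (hfh _ _) (abs_tailIntegral_le hfh hp) (abs_nonneg _) (hh0 _ _)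
  -- Conditioning on `m s` pulls out `f s` and turns the tail into `X s - Y s`. The σ-algebras need
  -- not be nested.
  have hneg : ∀ᵐ s ∂μ, ∫ ω, f s ω * tailIntegral T f s ω ∂P ≤ 0 := by
    filter_upwards [hamem', hfY.prod_right_ae] with s hs hi
    have hs' := Ico_subset_Icc_self hs
    have hfs : StronglyMeasurable[m s] (f s) := ((ham s hs').sub (hbm s hs')).stronglyMeasurable
    have e := condExp_mul_of_stronglyMeasurable_left hfs hi (tail_int (hai.sub hbi) s)
    rw [← integral_condExp (hm s hs')]
    refine integral_nonpos_of_ae ?_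
    filter_upwards [e, condSub s hs', hdiss s hs] with ω h1 h2 h3
    have h4 : P[fun ω => f s ω * tailIntegral T f s ω | m s] ω = f s ω * (X s ω - Y s ω) := by
      refine h1.trans ?_
      rw [Pi.mul_apply]
      congr 1
    rw [h4]
    exact h3
  intro t ht
  have hsq : (fun ω => tailIntegral T f t ω ^ 2) =ᵐ[P]
      fun ω => 2 * ∫ s, (Ioi t).indicator (fun s => f s ω * tailIntegral T f s ω) s ∂μ := by
    filter_upwards [(hai.sub hbi).prod_left_ae] with ω hω
    have hω' : IntegrableOn (fun u => f u ω) (Ioc t T) :=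
      IntegrableOn.mono_set hω (Ioc_subset_Ioc_left ht.1)
    rw [← intervalIntegral_eq_integral_indicator _ ht, tail_eq f t ht]
    simp only
    rw [sq_integral_eq_two_mul ht.2 hω']
    congr 1
    refine intervalIntegral.integral_congr fun s hs => ?_
    rw [uIcc_of_le ht.2] at hs
    simp only [tail_eq f s ⟨ht.1.trans hs.1, hs.2⟩]
  have hind : Integrable (fun p : ℝ × Ω =>
      (Ioi t).indicator (fun s => f s p.2 * tailIntegral T f s p.2) p.1) (μ.prod P) :=
    hfY.indicator (s := {p : ℝ × Ω | t < p.1}) (measurableSet_lt measurable_const measurable_fst)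
  have hsqi : Integrable (fun ω => tailIntegral T f t ω ^ 2) P :=
    (hind.integral_prod_right.const_mul 2).congr hsq.symm
  have hle : ∫ ω, tailIntegral T f t ω ^ 2 ∂P ≤ 0 := by
    rw [integral_congr_ae hsq, integral_const_mul]
    have hsw := integral_integral_swap (f := fun ω s =>
      (Ioi t).indicator (fun s => f s ω * tailIntegral T f s ω) s) (μ := P) (ν := μ) hind.swap
    rw [hsw]
    refine mul_nonpos_of_nonneg_of_nonpos zero_le_two (integral_nonpos_of_ae ?_)
    filter_upwards [hneg] with s hs
    by_cases hst : t < s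
    · simpa [indicator, hst] using hs
    · simp [indicator, hst]
  have hzero : tailIntegral T f t =ᵐ[P] 0 := by
    have h0 := (integral_eq_zero_iff_of_nonneg (fun ω => sq_nonneg _) hsqi).1
      (le_antisymm hle (integral_nonneg fun ω => sq_nonneg _))
    filter_upwards [h0] with ω hω
    simpa using hω
  have hc := (condSub t ht).symm.trans (condExp_congr_ae hzero)
  rw [condExp_zero] at hc
  filter_upwards [hc] with ω hω
  exact sub_eq_zero.1 hω

end Uniqueness

/-! ### The equation for `G`: measurability, uniqueness and verification. -/

section Equation

variable {Ω : Type*} [mΩ : MeasurableSpace Ω] {P : Measure Ω} {σ : ℝ → Ω → ℝ}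

/-- A right-continuous process is jointly measurable. -/
theorem measurable_of_right_continuous {T : ℝ} {X : ℝ → Ω → ℝ}
    (hm : ∀ t, 0 ≤ t → Measurable (X t))
    (hc : ∀ ω t, 0 ≤ t → ContinuousWithinAt (fun u => X u ω) (Ici t) t) :
    Measurable fun p : Icc (0 : ℝ) T × Ω => X p.1 p.2 := by
  -- The sampling times lie strictly to the right of `t`, within `1 / (n + 1)`, and take countably
  -- many values for each `n`. They may exceed `T`, which is harmless as the hypotheses cover all
  -- nonnegative times.
  refine measurable_of_tendsto_metrizable
    (f := fun (n : ℕ) (p : Icc (0 : ℝ) T × Ω) =>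
      X ((⌊((n : ℝ) + 1) * p.1⌋₊ + 1) / (n + 1)) p.2) (fun n => ?_) ?_
  · have h1 : Measurable fun q : ℕ × Ω => X (((q.1 : ℝ) + 1) / (n + 1)) q.2 :=
      measurable_from_prod_countable_right fun k => hm _ (by positivity : (0 : ℝ) ≤ ((k : ℝ) + 1) / (n + 1))
    have h2 : Measurable fun p : Icc (0 : ℝ) T × Ω => (⌊((n : ℝ) + 1) * p.1⌋₊, p.2) := by
      refine Measurable.prodMk (Nat.measurable_floor.comp ?_) measurable_snd
      exact (measurable_subtype_coe.comp measurable_fst).const_mul _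
    exact h1.comp h2
  · refine tendsto_pi_nhds.2 fun p => ?_
    have hp : (0 : ℝ) ≤ p.1 := p.1.2.1
    refine (hc p.2 p.1 hp).tendsto.comp (tendsto_nhdsWithin_iff.2 ⟨?_, ?_⟩)
    · have hlim : Tendsto (fun n : ℕ => (p.1 : ℝ) + 1 / ((n : ℝ) + 1)) atTop (𝓝 ((p.1 : ℝ) + 0)) :=
        tendsto_one_div_add_atTop_nhds_zero_nat.const_add _
      rw [add_zero] at hlim
      refine tendsto_of_tendsto_of_tendsto_of_le_of_le tendsto_const_nhds hlim (fun n => ?_)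
        fun n => ?_
      · simp only
        rw [le_div_iff₀ (by positivity), mul_comm]
        exact (Nat.lt_floor_add_one _).le
      · have h0 : (0 : ℝ) < (n : ℝ) + 1 := by positivity
        simp only
        have h1 : ((p.1 : ℝ) + 1 / ((n : ℝ) + 1)) * (n + 1) = (n + 1) * p.1 + 1 := by field_simp
        rw [div_le_iff₀ h0, h1]
        have := Nat.floor_le (mul_nonneg h0.le hp)
        linarith
    · refine Eventually.of_forall fun n => ?_
      rw [mem_Ici, le_div_iff₀ (by positivity), mul_comm]
      exact (Nat.lt_floor_add_one _).le

theorem measurable_history {Ω : Type*} {σ : ℝ → Ω → ℝ} {s t : ℝ} (hs : s ∈ Icc 0 t) : Measurable[history σ t] (σ s) :=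
  Measurable.mono (comap_measurable (σ s))
    (le_iSup₂_of_le (f := fun s (_ : s ∈ Icc 0 t) => MeasurableSpace.comap (σ s) inferInstance)
      s hs le_rfl) le_rfl

variable {𝔽 : Filtration ℝ mΩ} {NL NH : ℝ → Ω → ℕ} {lL lH σL σH : ℝ}

theorem IsVolatility.history_le (hvol : IsVolatility P 𝔽 NL NH σL σH σ) (t : ℝ) :
    history σ t ≤ 𝔽 t :=
  iSup₂_le fun s hs => (hvol.adapted s hs.1).comap_le.trans (𝔽.mono hs.2)

theorem IsVolatility.measurable_uncurry (hvol : IsVolatility P 𝔽 NL NH σL σH σ) (T : ℝ) :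
    Measurable fun p : Icc (0 : ℝ) T × Ω => σ p.1 p.2 :=
  measurable_of_right_continuous (fun _ => hvol.measurable) hvol.right_cont

/-- The integrand of the equation for `G`, extended constantly outside `[0, T]`. -/
def extendedIntegrand {T : ℝ} (hT : 0 ≤ T) (k : ℝ) (σ G : ℝ → Ω → ℝ) (s : ℝ) (ω : Ω) : ℝ :=
  k * σ (projIcc 0 T hT s) ω ^ 2 / (2 * √(G (projIcc 0 T hT s) ω))

theorem extendedIntegrand_of_mem {Ω : Type*} {T : ℝ} (hT : 0 ≤ T) (k : ℝ) (σ G : ℝ → Ω → ℝ) {s : ℝ}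
    (hs : s ∈ Icc 0 T) (ω : Ω) :
    extendedIntegrand hT k σ G s ω = k * σ s ω ^ 2 / (2 * √(G s ω)) := by
  rw [extendedIntegrand, projIcc_of_mem hT hs]

theorem measurable_extendedIntegrand {T : ℝ} (hT : 0 ≤ T) (k : ℝ) {G : ℝ → Ω → ℝ}
    (hσ : Measurable fun p : Icc (0 : ℝ) T × Ω => σ p.1 p.2)
    (hG : Measurable fun p : Icc (0 : ℝ) T × Ω => G p.1 p.2) :
    Measurable fun p : ℝ × Ω => extendedIntegrand hT k σ G p.1 p.2 := by
  have hπ : Measurable fun p : ℝ × Ω => (projIcc 0 T hT p.1, p.2) :=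
    (continuous_projIcc.measurable.comp measurable_fst).prodMk measurable_snd
  exact (((hσ.comp hπ).pow_const 2).const_mul k).div ((hG.comp hπ).sqrt.const_mul 2)

theorem ae_prod_fst_mem_Icc [SFinite P] (T : ℝ) :
    ∀ᵐ p ∂((volume.restrict (Ioc 0 T)).prod P), p.1 ∈ Icc 0 T :=
  Measure.quasiMeasurePreserving_fst.ae
    ((ae_restrict_mem measurableSet_Ioc).mono fun _ hs => Ioc_subset_Icc_self hs)

variable {T ε H : ℝ} {gL gH : ℝ → ℝ}

theorem stateProcess_low {Ω : Type*} {σ : ℝ → Ω → ℝ} (hσ : σL < σH) {t : ℝ} {ω : Ω}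
    (h : σ t ω = σL) :
    stateProcess σ σL σH T ε H gL gH t ω = ε ^ (2 * H - 1) * gL (T - t) := by
  have h' : σ t ω ≠ σH := h ▸ hσ.ne
  simp [stateProcess, indicator, h, hσ.ne]

theorem stateProcess_high {Ω : Type*} {σ : ℝ → Ω → ℝ} (hσ : σL < σH) {t : ℝ} {ω : Ω}
    (h : σ t ω = σH) :
    stateProcess σ σL σH T ε H gL gH t ω = ε ^ (2 * H - 1) * gH (T - t) := by
  simp [stateProcess, indicator, h, hσ.ne']

theorem sub_mem_Icc {t : ℝ} (ht : t ∈ Icc 0 T) : T - t ∈ Icc 0 T :=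
  ⟨sub_nonneg.2 ht.2, sub_le_self _ ht.1⟩

theorem measurable_stateProcess (hvol : IsVolatility P 𝔽 NL NH σL σH σ)
    (hg : IsODESolution σL σH lL lH T gL gH) :
    Measurable fun p : Icc (0 : ℝ) T × Ω => stateProcess σ σL σH T ε H gL gH p.1 p.2 := by
  have hσm := hvol.measurable_uncurry T
  have rev : ∀ g : ℝ → ℝ, ContinuousOn g (Icc 0 T) →
      Measurable fun p : Icc (0 : ℝ) T × Ω => ε ^ (2 * H - 1) * g (T - p.1) := fun g hc => by
    have h1 : Continuous fun x : Icc (0 : ℝ) T => g (T - x) :=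
      hc.comp_continuous (by fun_prop) fun x => sub_mem_Icc x.2
    exact (h1.measurable.comp measurable_fst).const_mul _
  exact ((rev gL hg.continuousOn_low).indicator (hσm (measurableSet_singleton σL))).add
    ((rev gH hg.symm.continuousOn_low).indicator (hσm (measurableSet_singleton σH)))

variable [IsProbabilityMeasure P]

/-- The equation for `G` has at most one bounded solution. -/
theorem IsBoundedSolution.ae_eq {G K : ℝ → Ω → ℝ} (hG : IsBoundedSolution P σ T ε H G)
    (hK : IsBoundedSolution P σ T ε H K) (hvol : IsVolatility P 𝔽 NL NH σL σH σ)
    (hT : 0 ≤ T) (hε : 0 < ε) : ∀ t ∈ Icc 0 T, G t =ᵐ[P] K t := by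
  have hk : 0 ≤ ε ^ (2 * H - 1) := Real.rpow_nonneg hε.le _
  set k := ε ^ (2 * H - 1) with hkdef
  have hσm := hvol.measurable_uncurry T
  obtain ⟨C, hC⟩ := hG.bounded
  obtain ⟨D, hD⟩ := hK.bounded
  have eqn : ∀ {F : ℝ → Ω → ℝ}, IsBoundedSolution P σ T ε H F → ∀ t ∈ Icc 0 T,
      (fun ω => √(F t ω)) =ᵐ[P]
        P[fun ω => ∫ s in t..T, extendedIntegrand hT k σ F s ω | history σ t] := by
    intro F hF t ht
    have e : (fun ω => ∫ s in t..T, extendedIntegrand hT k σ F s ω) =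
        fun ω => ∫ s in t..T, k * σ s ω ^ 2 / (2 * √(F s ω)) := by
      funext ω
      refine intervalIntegral.integral_congr fun s hs => ?_
      rw [uIcc_of_le ht.2] at hs
      exact extendedIntegrand_of_mem hT k σ F ⟨ht.1.trans hs.1, hs.2⟩ ω
    rw [e]
    exact hF.eqn t ht
  have adapt : ∀ {F : ℝ → Ω → ℝ}, IsBoundedSolution P σ T ε H F → ∀ t ∈ Icc 0 T,
      Measurable[history σ t] (extendedIntegrand hT k σ F t) := by
    intro F hF t ht
    have e : extendedIntegrand hT k σ F t = fun ω => k * σ t ω ^ 2 / (2 * √(F t ω)) :=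
      funext fun ω => extendedIntegrand_of_mem hT k σ F ht ω
    rw [e]
    have h1 : Measurable[history σ t] (σ t) := measurable_history ⟨ht.1, le_rfl⟩
    exact ((h1.pow_const 2).const_mul k).div ((hF.adapted t ht).sqrt.const_mul 2)
  have nonneg : ∀ (F : ℝ → Ω → ℝ) (t ω), 0 ≤ extendedIntegrand hT k σ F t ω := fun F t ω => by
    unfold extendedIntegrand; positivity
  have integ : ∀ {F : ℝ → Ω → ℝ}, IsBoundedSolution P σ T ε H F →
      Integrable (fun p : ℝ × Ω => extendedIntegrand hT k σ F p.1 p.2)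
        ((volume.restrict (Ioc 0 T)).prod P) := by
    intro F hF
    refine hF.integrable.congr ?_
    filter_upwards [ae_prod_fst_mem_Icc T] with p hp
    exact (extendedIntegrand_of_mem hT k σ F hp p.2).symm
  have key := ae_eq_of_backward_eq (C := √(max C D))
    (fun t _ => (hvol.history_le t).trans (𝔽.le t))
    (measurable_extendedIntegrand hT k hσm hG.measurable)
    (measurable_extendedIntegrand hT k hσm hK.measurable)
    (nonneg G) (nonneg K) (adapt hG) (adapt hK) (integ hG) (integ hK) (eqn hG) (eqn hK)
    (fun t ht => (hC t ht).mono fun ω h => Real.sqrt_le_sqrt (h.trans (le_max_left _ _)))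
    (fun t ht => (hD t ht).mono fun ω h => Real.sqrt_le_sqrt (h.trans (le_max_right _ _))) ?_
  · intro t ht
    filter_upwards [key t ht, hG.nonneg t ht, hK.nonneg t ht] with ω h1 h2 h3
    exact (Real.sqrt_inj h2 h3).1 h1
  · intro t ht
    filter_upwards [hG.pos t ht, hK.pos t ht] with ω h1 h2
    have ht' := Ico_subset_Icc_self ht
    rw [extendedIntegrand_of_mem hT k σ G ht', extendedIntegrand_of_mem hT k σ K ht']
    have x0 := Real.sqrt_pos.2 h1
    have y0 := Real.sqrt_pos.2 h2
    generalize √(G t ω) = x at *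
    generalize √(K t ω) = y at *
    -- Dissipativity: the integrand decreases in the square root.
    have e : (k * σ t ω ^ 2 / (2 * x) - k * σ t ω ^ 2 / (2 * y)) * (x - y) =
        -(k * σ t ω ^ 2 * (x - y) ^ 2 / (2 * x * y)) := by field_simp; ring
    rw [e]
    exact neg_nonpos.2 (by positivity)

/-- The mean over an event of a function of a two-valued variable. -/
theorem setIntegral_two_states {S X : Ω → ℝ} (hS : Measurable S)
    (h2 : ∀ᵐ ω ∂P, S ω = σL ∨ S ω = σH) (hσ : σL < σH) {c d : ℝ}
    (hc : ∀ ω, S ω = σL → X ω = c) (hd : ∀ ω, S ω = σH → X ω = d) (A : Set Ω) :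
    Integrable X P ∧ ∫ ω in A, X ω ∂P =
      (P.real A - P.real (A ∩ {ω | S ω = σH})) * c + P.real (A ∩ {ω | S ω = σH}) * d := by
  have hmH : MeasurableSet {ω | S ω = σH} := hS (measurableSet_singleton σH)
  have e : X =ᵐ[P] fun ω => c + {ω | S ω = σH}.indicator (fun _ => d - c) ω := by
    filter_upwards [h2] with ω h
    rcases h with h | h
    · simp [hc ω h, h, hσ.ne]
    · simp [hd ω h, h]
  have hi : Integrable ({ω | S ω = σH}.indicator fun _ => d - c) P :=
    (integrable_const _).indicator hmH
  refine ⟨((integrable_const c).add hi).congr e.symm, ?_⟩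
  rw [integral_congr_ae (ae_restrict_of_ae e),
    integral_add (integrable_const c).integrableOn hi.integrableOn, setIntegral_const,
    integral_indicator hmH, Measure.restrict_restrict hmH, setIntegral_const, inter_comm,
    smul_eq_mul, smul_eq_mul]
  ring

/-- The backward function integrated along a solution of the forward equation. -/
theorem IsODESolution.integral_forward (hg : IsODESolution σL σH lL lH T gL gH) (hσL : 0 < σL)
    (hσH : 0 < σH) (hlL : 0 < lL) (hlH : 0 < lH) {k : ℝ} (hk : 0 < k) {t : ℝ} (ht : t ∈ Icc 0 T)
    {p : ℝ → ℝ} {r : ℝ}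
    (hp : ∀ s, t ≤ s → HasDerivWithinAt p (lL * r - (lL + lH) * p s) (Ici t) s)
    (hp0 : ∀ s, 0 ≤ p s) (hpr : ∀ s, p s ≤ r) :
    IntegrableOn (fun s => (r - p s) * (k * σL ^ 2 / (2 * √(k * gL (T - s)))) +
      p s * (k * σH ^ 2 / (2 * √(k * gH (T - s))))) (Ioc t T) ∧
    ∫ s in t..T, ((r - p s) * (k * σL ^ 2 / (2 * √(k * gL (T - s)))) +
      p s * (k * σH ^ 2 / (2 * √(k * gH (T - s))))) =
    (r - p t) * √(k * gL (T - t)) + p t * √(k * gH (T - t)) := by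
  -- The sign makes the derivative of `Φ` equal to the nonnegative integrand.
  set Φ : ℝ → ℝ := fun s => -((r - p s) * √(k * gL (T - s)) + p s * √(k * gH (T - s))) with hΦ
  have hcp : ContinuousOn p (Icc t T) := fun s hs =>
    (hp s hs.1).continuousWithinAt.mono Icc_subset_Ici_self
  have rev : ∀ g : ℝ → ℝ, ContinuousOn g (Icc 0 T) → ContinuousOn (fun s => g (T - s)) (Icc t T) :=
    fun g hc => hc.comp (by fun_prop) fun s hs => sub_mem_Icc ⟨ht.1.trans hs.1, hs.2⟩
  have hcont : ContinuousOn Φ (Icc t T) := by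
    have c1 := rev gL hg.continuousOn_low
    have c2 := rev gH hg.symm.continuousOn_low
    exact (((continuousOn_const.sub hcp).mul (c1.const_mul k).sqrt).add
      (hcp.mul (c2.const_mul k).sqrt)).neg
  have hderiv : ∀ s ∈ Ioo t T, HasDerivAt Φ
      ((r - p s) * (k * σL ^ 2 / (2 * √(k * gL (T - s)))) +
        p s * (k * σH ^ 2 / (2 * √(k * gH (T - s))))) s := by
    intro s hs
    have hTs : T - s ∈ Ioo 0 T := ⟨by linarith [hs.2], by linarith [ht.1, hs.1]⟩
    have d0 : HasDerivAt p (lL * r - (lL + lH) * p s) s :=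
      (hp s hs.1.le).hasDerivAt (Ici_mem_nhds hs.1)
    have d1 := (hg.hasDerivAt_sqrt_low hσL hlL hTs).comp_const_sub T s
    have d2 := (hg.symm.hasDerivAt_sqrt_low hσH hlH hTs).comp_const_sub T s
    have x0 := Real.sqrt_pos.2 (hg.pos_low hσL hlL (Ioo_subset_Ioc_self hTs))
    have y0 := Real.sqrt_pos.2 (hg.symm.pos_low hσH hlH (Ioo_subset_Ioc_self hTs))
    have hk0 := Real.sqrt_pos.2 hk
    have hkk : √k ^ 2 = k := Real.sq_sqrt hk.le
    simp only [hΦ, Real.sqrt_mul hk.le]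
    -- Since `p' = lL (r - p) - lH p`, the terms from `p'` cancel the coupling terms of the two
    -- square roots.
    convert! (((d0.const_sub r).mul (d1.const_mul √k)).add (d0.mul (d2.const_mul √k))).neg using 1
    generalize √(gL (T - s)) = x at *
    generalize √(gH (T - s)) = y at *
    rw [← hkk]
    simp only [Real.sqrt_sq hk0.le]
    field_simp
    ring
  -- The integrand is singular at `s = T`, where the solution vanishes; it is integrable because it
  -- is nonnegative and has a continuous primitive.
  have hint := intervalIntegral.integrableOn_deriv_of_nonneg hcont hderiv fun s _ => by
    have := hp0 s
    have := sub_nonneg.2 (hpr s)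
    positivity
  refine ⟨hint, ?_⟩
  rw [intervalIntegral.integral_eq_sub_of_hasDerivAt_of_le ht.2 hcont hderiv
    ((intervalIntegrable_iff_integrableOn_Ioc_of_le ht.2).2 hint)]
  simp [hΦ, hg.initial_low, hg.initial_high]

/-- The set-integral identity holds for every event of `𝔽 t`. It is needed only for the smaller
history of `σ`, to which the candidate is adapted because it depends on `σ t` alone. -/
theorem isBoundedSolution_stateProcess (hN : IsIndepPoissonPair P 𝔽 NL NH lL lH) (hlL : 0 < lL)
    (hlH : 0 < lH) (hvol : IsVolatility P 𝔽 NL NH σL σH σ) (hσL : 0 < σL) (hσ : σL < σH)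
    (hT : 0 ≤ T) (hε : 0 < ε) (hg : IsODESolution σL σH lL lH T gL gH) :
    IsBoundedSolution P σ T ε H (stateProcess σ σL σH T ε H gL gH) := by
  have hσH : 0 < σH := hσL.trans hσ
  have hk : 0 < ε ^ (2 * H - 1) := Real.rpow_pos_of_pos hε _
  set G := stateProcess σ σL σH T ε H gL gH with hG
  have hlow : ∀ {t ω}, σ t ω = σL → G t ω = ε ^ (2 * H - 1) * gL (T - t) := stateProcess_low hσ
  have hhigh : ∀ {t ω}, σ t ω = σH → G t ω = ε ^ (2 * H - 1) * gH (T - t) := stateProcess_high hσ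
  have h2 : ∀ t, 0 ≤ t → ∀ᵐ ω ∂P, σ t ω = σL ∨ σ t ω = σH := fun t ht =>
    hvol.ae_two_states hN hlL.le hlH.le ht
  have hGm : Measurable fun p : Icc (0 : ℝ) T × Ω => G p.1 p.2 := measurable_stateProcess hvol hg
  set k := ε ^ (2 * H - 1)
  have adapted : ∀ t ∈ Icc 0 T, Measurable[history σ t] (G t) := fun t ht => by
    have hm : Measurable[history σ t] (σ t) := measurable_history ⟨ht.1, le_rfl⟩
    exact (measurable_const.indicator (hm (measurableSet_singleton σL))).add
      (measurable_const.indicator (hm (measurableSet_singleton σH)))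
  have mean : ∀ s ∈ Icc 0 T, ∀ A : Set Ω,
      Integrable (fun ω => k * σ s ω ^ 2 / (2 * √(G s ω))) P ∧
      ∫ ω in A, k * σ s ω ^ 2 / (2 * √(G s ω)) ∂P =
      (P.real A - P.real (A ∩ {ω | σ s ω = σH})) * (k * σL ^ 2 / (2 * √(k * gL (T - s)))) +
        P.real (A ∩ {ω | σ s ω = σH}) * (k * σH ^ 2 / (2 * √(k * gH (T - s)))) := fun s hs A =>
    setIntegral_two_states (hvol.measurable hs.1) (h2 s hs.1) hσ
      (fun ω h => by rw [hlow h, h]) (fun ω h => by rw [hhigh h, h]) A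
  have forward : ∀ t ∈ Icc 0 T, ∀ A, MeasurableSet[𝔽 t] A →
      IntegrableOn (fun s => (P.real A - P.real (A ∩ {ω | σ s ω = σH})) *
          (k * σL ^ 2 / (2 * √(k * gL (T - s)))) +
        P.real (A ∩ {ω | σ s ω = σH}) * (k * σH ^ 2 / (2 * √(k * gH (T - s))))) (Ioc t T) ∧
      ∫ s in t..T, ((P.real A - P.real (A ∩ {ω | σ s ω = σH})) *
          (k * σL ^ 2 / (2 * √(k * gL (T - s)))) +
        P.real (A ∩ {ω | σ s ω = σH}) * (k * σH ^ 2 / (2 * √(k * gH (T - s))))) =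
      (P.real A - P.real (A ∩ {ω | σ t ω = σH})) * √(k * gL (T - t)) +
        P.real (A ∩ {ω | σ t ω = σH}) * √(k * gH (T - t)) := fun t ht A hA =>
    hg.integral_forward hσL hσH hlL hlH hk ht
      (p := fun s => P.real (A ∩ {ω | σ s ω = σH})) (r := P.real A)
      (fun s hs => hvol.hasDerivWithinAt_real_high hN hlL.le hlH.le hσ ht.1 hs hA)
      (fun _ => measureReal_nonneg) (fun _ => measureReal_mono inter_subset_left)
  have hint : Integrable (fun p : ℝ × Ω => k * σ p.1 p.2 ^ 2 / (2 * √(G p.1 p.2)))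
      ((volume.restrict (Ioc 0 T)).prod P) := by
    have hsm : AEStronglyMeasurable (fun p : ℝ × Ω => k * σ p.1 p.2 ^ 2 / (2 * √(G p.1 p.2)))
        ((volume.restrict (Ioc 0 T)).prod P) := by
      refine (measurable_extendedIntegrand hT k (hvol.measurable_uncurry T)
        hGm).aestronglyMeasurable.congr ?_
      filter_upwards [ae_prod_fst_mem_Icc T] with p hp
      exact extendedIntegrand_of_mem hT k σ G hp p.2
    rw [integrable_prod_iff hsm]
    have hmem : ∀ᵐ s ∂(volume.restrict (Ioc 0 T)), s ∈ Icc 0 T :=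
      (ae_restrict_mem measurableSet_Ioc).mono fun _ hs => Ioc_subset_Icc_self hs
    refine ⟨hmem.mono fun s hs => (mean s hs univ).1, ?_⟩
    -- By nonnegativity the norm has the same mean as the integrand, so the case `t = 0`, `A = univ`
    -- of the forward identity gives integrability on the product space.
    refine (forward 0 ⟨le_rfl, hT⟩ univ .univ).1.congr ?_
    filter_upwards [hmem] with s hs
    rw [← (mean s hs univ).2, setIntegral_univ]
    refine integral_congr_ae (ae_of_all _ fun ω => ?_)
    exact (Real.norm_of_nonneg (by positivity)).symm
  obtain ⟨ML, hML⟩ := isCompact_Icc.exists_bound_of_continuousOn hg.continuousOn_low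
  obtain ⟨MH, hMH⟩ := isCompact_Icc.exists_bound_of_continuousOn hg.symm.continuousOn_low
  refine ⟨hGm, adapted, fun t ht => ?_, fun t ht => ?_, ⟨k * max ML MH, fun t ht => ?_⟩, hint,
    fun t ht => ?_⟩
  · filter_upwards [h2 t ht.1] with ω h
    rcases h with h | h
    · rw [hlow h]; exact mul_nonneg hk.le (hg.nonneg_low _ (sub_mem_Icc ht))
    · rw [hhigh h]; exact mul_nonneg hk.le (hg.nonneg_high _ (sub_mem_Icc ht))
  · have hm : T - t ∈ Ioc 0 T := ⟨sub_pos.2 ht.2, sub_le_self _ ht.1⟩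
    filter_upwards [h2 t ht.1] with ω h
    rcases h with h | h
    · rw [hlow h]; exact mul_pos hk (hg.pos_low hσL hlL hm)
    · rw [hhigh h]; exact mul_pos hk (hg.symm.pos_low hσH hlH hm)
  · filter_upwards [h2 t ht.1] with ω h
    rcases h with h | h
    · rw [hlow h]
      exact mul_le_mul_of_nonneg_left (((le_abs_self _).trans (hML _ (sub_mem_Icc ht))).trans
        (le_max_left _ _)) hk.le
    · rw [hhigh h]
      exact mul_le_mul_of_nonneg_left (((le_abs_self _).trans (hMH _ (sub_mem_Icc ht))).trans
        (le_max_right _ _)) hk.le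
  · have hle : history σ t ≤ mΩ := (hvol.history_le t).trans (𝔽.le t)
    have hintT : Integrable (fun p : ℝ × Ω => k * σ p.1 p.2 ^ 2 / (2 * √(G p.1 p.2)))
        ((volume.restrict (Ioc t T)).prod P) :=
      hint.mono_measure (Measure.prod_mono (Measure.restrict_mono
        (Ioc_subset_Ioc_left ht.1) le_rfl) le_rfl)
    have meanSqrt := setIntegral_two_states (hvol.measurable ht.1) (h2 t ht.1) hσ
      (X := fun ω => √(G t ω)) (fun ω h => by rw [hlow h]) (fun ω h => by rw [hhigh h])
    refine ae_eq_condExp_of_forall_setIntegral_eq hle ?_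
      (fun A _ _ => (meanSqrt univ).1.integrableOn) (fun A hA _ => ?_)
      (adapted t ht).sqrt.stronglyMeasurable.aestronglyMeasurable
    · simp only [intervalIntegral.integral_of_le ht.2]
      exact hintT.integral_prod_right
    · rw [(meanSqrt A).2, ← (forward t ht A (hvol.history_le t _ hA)).2]
      simp only [intervalIntegral.integral_of_le ht.2]
      have hintA : Integrable (fun p : ℝ × Ω => k * σ p.1 p.2 ^ 2 / (2 * √(G p.1 p.2)))
          ((volume.restrict (Ioc t T)).prod (P.restrict A)) :=
        hintT.mono_measure (Measure.prod_mono le_rfl Measure.restrict_le_self)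
      -- After Fubini, the mean over `A` at each time `s` is the integrand of the forward identity.
      rw [integral_integral_swap (f := fun ω s => k * σ s ω ^ 2 / (2 * √(G s ω))) hintA.swap]
      refine setIntegral_congr_fun measurableSet_Ioc fun s hs => ?_
      exact (mean s ⟨ht.1.trans hs.1.le, hs.2⟩ A).2.symm

end Equation

end TwoStateVolatility

end

theorem mainTheorem7 {Ω : Type*} [mΩ : MeasurableSpace Ω] (P : Measure Ω) [IsProbabilityMeasure P]
    (𝔽 : Filtration ℝ mΩ) (NL NH : ℝ → Ω → ℕ) (lL lH : ℝ) (hlL : 0 < lL) (hlH : 0 < lH)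
    (hN : TwoStateVolatility.IsIndepPoissonPair P 𝔽 NL NH lL lH)
    (σL σH : ℝ) (hσL : 0 < σL) (hσ : σL < σH) (σ : ℝ → Ω → ℝ)
    (hvol : TwoStateVolatility.IsVolatility P 𝔽 NL NH σL σH σ)
    (T ε H : ℝ) (hT : 0 < T) (hε : 0 < ε) (hH : 1 / 2 < H) (hH1 : H ≤ 1) :
    ∃ gL gH : ℝ → ℝ,
      TwoStateVolatility.IsODESolution σL σH lL lH T gL gH ∧
      (∀ KL KH : ℝ → ℝ, TwoStateVolatility.IsODESolution σL σH lL lH T KL KH →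
        EqOn KL gL (Icc 0 T) ∧ EqOn KH gH (Icc 0 T)) ∧
      TwoStateVolatility.IsBoundedSolution P σ T ε H
        (TwoStateVolatility.stateProcess σ σL σH T ε H gL gH) ∧
      ∀ G : ℝ → Ω → ℝ, TwoStateVolatility.IsBoundedSolution P σ T ε H G →
        ∀ t ∈ Icc 0 T,
          G t =ᵐ[P] TwoStateVolatility.stateProcess σ σL σH T ε H gL gH t := by
  obtain ⟨gL, gH, hg⟩ := TwoStateVolatility.exists_isODESolution hσL hσ hlL hlH hT
  have hsol := TwoStateVolatility.isBoundedSolution_stateProcess (ε := ε) (H := H) hN hlL hlH hvol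
    hσL hσ hT.le hε hg
  exact ⟨gL, gH, hg, fun KL KH hK => ⟨hg.eqOn_low hK hσL (hσL.trans hσ) hlL hlH,
    hg.symm.eqOn_low hK.symm (hσL.trans hσ) hσL hlH hlL⟩, hsol,
    fun G hG => hG.ae_eq hsol hvol hT.le hε⟩
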